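/- Let $\Omega\subset\mathbb{R}^2$ be a smooth bounded domain which is star-shaped (with respect to one of its points), and let $Q=\Omega\times(0,1)$, with $\Gamma_0=\Omega\times\{0\}$ and $\Gamma_1=\Omega\times\{1\}$. Let $$\widetilde H^{1}_0(Q)=\{u\in H^1(Q)^3 \;|\; \mathrm{div}\,u=0;\ u|_{\partial\Omega\times(0,1)}=0;\ u_3=0 \text{ on } \Gamma_0\cup\Gamma_1\},$$ where the boundary conditions are understood in the sense of traces, and let $$\widetilde H^{0,1}(Q)=\{u\in L^2(Q)^3 \;|\; \mathrm{div}\,u=0;\ \gamma_n u=0 \text{ on } \partial Q;\ \partial_3 u\in L^2(Q)^3\},$$ where $\gamma_n u\in H^{-1/2}(\partial Q)$ is the normal trace of the divergence-free field $u$, that is, the functional $\psi|_{\partial Q}\mapsto\int_Q u\cdot\nabla\psi\,dx$ for $\psi\in H^1(Q)$. Equip $\widetilde H^{0,1}(Q)$ with the norm $(\|u\|_{L^2(Q)}^2+\|\partial_3u\|_{L^2(Q)}^2)^{1/2}$. Then $\widetilde H^1_0(Q)$ is contained in $\widetilde H^{0,1}(Q)$ and is dense in it. -/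

import Mathlib

open MeasureTheory Set Topology
open scoped ContDiff ENNReal

noncomputable section

namespace AnisotropicNS

/-- The horizontal plane `ℝ²`. -/
abbrev Plane : Type := EuclideanSpace ℝ (Fin 2)

/-- Points `x = (x_h, x₃)` of `ℝ² × ℝ = ℝ³`; `volume` is the product Lebesgue measure. -/
abbrev Space : Type := Plane × ℝ

/-- The three coordinate directions of `ℝ² × ℝ`. -/
def dir : Fin 3 → Space :=
  ![(EuclideanSpace.single 0 1, 0), (EuclideanSpace.single 1 1, 0), (0, 1)]

/-- The classical partial derivative `∂ᵢ φ`. -/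
def partialDeriv (i : Fin 3) (φ : Space → ℝ) (x : Space) : ℝ := fderiv ℝ φ x (dir i)

/-- The boundary of the open set `Ω` is smooth: near each boundary point `Ω` is the negativity set
of a smooth function with non-vanishing differential, so that `Ω` lies locally on one side of the
smooth curve `∂Ω`. -/
def HasSmoothBoundary (Ω : Set Plane) : Prop :=
  ∀ x ∈ frontier Ω, ∃ U ∈ 𝓝 x, ∃ ρ : Plane → ℝ,
    ContDiff ℝ ∞ ρ ∧ fderiv ℝ ρ x ≠ 0 ∧ Ω ∩ U = {y ∈ U | ρ y < 0}

/-- The cylinder `Q = Ω × (0,1)`. -/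
def cylinder (Ω : TopologicalSpace.Opens Plane) : Set Space := (Ω : Set Plane) ×ˢ Ioo (0 : ℝ) 1

/-- The lateral boundary `∂Ω × (0,1)`. -/
def lateral (Ω : TopologicalSpace.Opens Plane) : Set Space :=
  frontier (Ω : Set Plane) ×ˢ Ioo (0 : ℝ) 1

/-- The horizontal faces `Γ₀ ∪ Γ₁ = Ω × {0} ∪ Ω × {1}`. -/
def faces (Ω : TopologicalSpace.Opens Plane) : Set Space :=
  ((Ω : Set Plane) ×ˢ {(0 : ℝ)}) ∪ ((Ω : Set Plane) ×ˢ {(1 : ℝ)})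

/-- The real space `L²(Q)`. -/
abbrev L2 (Q : Set Space) : Type := Lp ℝ 2 (volume.restrict Q)

/-- The Hilbert space `L²(Q)³`. -/
abbrev L2Field (Q : Set Space) : Type := PiLp 2 fun _ : Fin 3 => L2 Q

/-- Test functions: `φ ∈ C_c^∞(Q)`. -/
def IsTest (Q : Set Space) (φ : Space → ℝ) : Prop :=
  ContDiff ℝ ∞ φ ∧ HasCompactSupport φ ∧ tsupport φ ⊆ Q

/-- `g = ∂ᵢ f` in the sense of distributions on `Q`. -/
def HasWeakPartial {Q : Set Space} (i : Fin 3) (f g : L2 Q) : Prop :=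
  ∀ φ : Space → ℝ, IsTest Q φ →
    ∫ x in Q, f x * partialDeriv i φ x = -∫ x in Q, g x * φ x

/-- `div u = 0` in the sense of distributions on `Q`. -/
def IsDivFree {Q : Set Space} (u : L2Field Q) : Prop :=
  ∀ φ : Space → ℝ, IsTest Q φ → ∑ i, ∫ x in Q, u i x * partialDeriv i φ x = 0

/-- For divergence-free `u ∈ L²(Q)³`, the normal trace `γₙ u ∈ H^{-1/2}(∂Q)` is the functional
`ψ|_{∂Q} ↦ ∫_Q (u · ∇ψ + (div u) ψ) = ∫_Q u · ∇ψ`, for `ψ ∈ H¹(Q)`; this says that it is zero. -/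
def NormalTraceEqZero {Q : Set Space} (u : L2Field Q) : Prop :=
  ∀ (ψ : L2 Q) (g : Fin 3 → L2 Q), (∀ i, HasWeakPartial i ψ (g i)) →
    ∑ i, ∫ x in Q, u i x * g i x = 0

/-- `f ∈ H¹(Q)`. -/
def MemH1 {Q : Set Space} (f : L2 Q) : Prop := ∀ i, ∃ g : L2 Q, HasWeakPartial i f g

/-- `f ∈ H¹(Q)` vanishes on the part `Γ` of the boundary: `f` is a limit in `H¹(Q)` of functions
that are smooth up to the boundary and vanish in a neighbourhood of `closure Γ`. (For the cylinders `Q` over smooth `Ω` and `Γ` the lateral boundary or the horizontal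
faces, this is the space of `H¹` functions whose trace on `Γ` is zero.) -/
def VanishesOn {Q : Set Space} (Γ : Set Space) (f : L2 Q) : Prop :=
  ∃ g : Fin 3 → L2 Q, (∀ i, HasWeakPartial i f (g i)) ∧
    ∀ ε : ℝ≥0∞, 0 < ε → ∃ φ : Space → ℝ, ContDiff ℝ ∞ φ ∧ Disjoint (tsupport φ) (closure Γ) ∧
      eLpNorm (fun x => f x - φ x) 2 (volume.restrict Q) < ε ∧
      ∀ i, eLpNorm (fun x => g i x - partialDeriv i φ x) 2 (volume.restrict Q) < ε

/-- The space of divergence-free `u ∈ H¹(Q)³` with `u = 0` on `∂Ω × (0,1)` and `u₃ = 0` on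
`Γ₀ ∪ Γ₁`. -/
def HTilde10 (Ω : TopologicalSpace.Opens Plane) : Set (L2Field (cylinder Ω)) :=
  {u | (∀ i, MemH1 (u i)) ∧ IsDivFree u ∧ (∀ i, VanishesOn (lateral Ω) (u i)) ∧
    VanishesOn (faces Ω) (u 2)}

/-! ### Elementary facts on weak derivatives -/

lemma isOpen_cylinder (Ω : TopologicalSpace.Opens Plane) : IsOpen (cylinder Ω) :=
  Ω.isOpen.prod isOpen_Ioo

lemma IsTest.memLp {Q : Set Space} {φ : Space → ℝ} (h : IsTest Q φ) :
    MemLp φ 2 (volume.restrict Q) :=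
  (h.1.continuous.memLp_of_hasCompactSupport h.2.1).restrict Q

lemma IsTest.memLp_partialDeriv {Q : Set Space} {φ : Space → ℝ} (h : IsTest Q φ) (i : Fin 3) :
    MemLp (partialDeriv i φ) 2 (volume.restrict Q) := by
  have h1 : Continuous (partialDeriv i φ) :=
    (h.1.continuous_fderiv (by simp)).clm_apply continuous_const
  have h2 : HasCompactSupport (partialDeriv i φ) :=
    h.2.1.fderiv_apply (𝕜 := ℝ) (dir i)
  exact (h1.memLp_of_hasCompactSupport h2).restrict Q

lemma integral_add_mul {Q : Set Space} (f g : L2 Q) {φ : Space → ℝ}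
    (h : MemLp φ 2 (volume.restrict Q)) :
    ∫ x in Q, (f + g : L2 Q) x * φ x = (∫ x in Q, f x * φ x) + ∫ x in Q, g x * φ x := by
  have e := integral_add ((Lp.memLp f).integrable_mul h) ((Lp.memLp g).integrable_mul h)
  refine Eq.trans (integral_congr_ae ?_) e
  filter_upwards [Lp.coeFn_add f g] with x hx
  simp only [hx, Pi.add_apply, Pi.mul_apply, add_mul]

lemma integral_smul_mul {Q : Set Space} (c : ℝ) (f : L2 Q) (φ : Space → ℝ) :
    ∫ x in Q, (c • f : L2 Q) x * φ x = c * ∫ x in Q, f x * φ x := by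
  rw [← integral_const_mul]
  refine integral_congr_ae ?_
  filter_upwards [Lp.coeFn_smul c f] with x hx
  rw [hx, Pi.smul_apply, smul_eq_mul, mul_assoc]

lemma integral_zero_mul {Q : Set Space} (φ : Space → ℝ) :
    ∫ x in Q, (0 : L2 Q) x * φ x = 0 := by
  simpa using integral_smul_mul (0 : ℝ) (0 : L2 Q) φ

lemma HasWeakPartial.zero {Q : Set Space} (i : Fin 3) : HasWeakPartial i (0 : L2 Q) 0 := by
  intro φ _
  simp only [integral_zero_mul, neg_zero]

lemma HasWeakPartial.add {Q : Set Space} {i : Fin 3} {f g f' g' : L2 Q}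
    (h : HasWeakPartial i f g) (h' : HasWeakPartial i f' g') :
    HasWeakPartial i (f + f') (g + g') := by
  intro φ hφ
  rw [integral_add_mul _ _ (hφ.memLp_partialDeriv i), integral_add_mul _ _ hφ.memLp, h φ hφ,
    h' φ hφ, neg_add]

lemma HasWeakPartial.smul {Q : Set Space} {i : Fin 3} {f g : L2 Q} (c : ℝ)
    (h : HasWeakPartial i f g) : HasWeakPartial i (c • f) (c • g) := by
  intro φ hφ
  rw [integral_smul_mul, integral_smul_mul, h φ hφ, mul_neg]

lemma HasWeakPartial.unique {Q : Set Space} (hQ : IsOpen Q) {i : Fin 3} {f g g' : L2 Q}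
    (h : HasWeakPartial i f g) (h' : HasWeakPartial i f g') : g = g' := by
  have key : ∀ᵐ x ∂(volume : Measure Space), x ∈ Q → (g x - g' x) = 0 := by
    refine hQ.ae_eq_zero_of_integral_contDiff_smul_eq_zero ?_ ?_
    · have h1 : LocallyIntegrable (fun x => g x - g' x) (volume.restrict Q) :=
        ((Lp.memLp g).sub (Lp.memLp g')).locallyIntegrable (by norm_num)
      intro x hx
      obtain ⟨s, hs, hint⟩ := h1 x
      obtain ⟨r, hr, hrs⟩ := Metric.mem_nhds_iff.1 (Filter.inter_mem hs (hQ.mem_nhds hx))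
      refine ⟨Metric.ball x r, mem_nhdsWithin_of_mem_nhds (Metric.ball_mem_nhds x hr), ?_⟩
      have h2 := hint.mono_set (fun y hy => (hrs hy).1)
      rwa [IntegrableOn, Measure.restrict_restrict Metric.isOpen_ball.measurableSet,
        inter_eq_left.2 (fun y hy => (hrs hy).2)] at h2
    · intro φ hφ hc hs
      have ht : IsTest Q φ := ⟨hφ, hc, hs⟩
      have e1 := h φ ht
      rw [h' φ ht, neg_inj] at e1
      have e2 : ∫ x in Q, φ x • (g x - g' x) = 0 := by
        have : ∀ x, φ x • (g x - g' x) = g x * φ x - g' x * φ x := by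
          intro x; rw [smul_eq_mul]; ring
        simp only [this]
        have e3 := integral_sub ((Lp.memLp g).integrable_mul ht.memLp)
          ((Lp.memLp g').integrable_mul ht.memLp)
        simp only [Pi.mul_apply] at e3
        rw [e3, e1, sub_self]
      rw [← e2]
      symm
      refine setIntegral_eq_integral_of_forall_compl_eq_zero ?_
      intro x hx
      have : φ x = 0 := by
        by_contra hne
        exact hx (hs (subset_tsupport φ hne))
      rw [this, zero_smul]
  refine Lp.ext ?_
  refine (ae_restrict_iff' hQ.measurableSet).2 ?_
  filter_upwards [key] with x hx hxQ
  exact sub_eq_zero.1 (hx hxQ)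

/-- The vector space of divergence-free `u ∈ L²(Q)³` with `γₙ u = 0` on `∂Q` and
`∂₃ u ∈ L²(Q)³`. -/
def hTilde01 (Ω : TopologicalSpace.Opens Plane) : Submodule ℝ (L2Field (cylinder Ω)) where
  carrier := {u | IsDivFree u ∧ NormalTraceEqZero u ∧ ∃ w : L2Field (cylinder Ω),
    ∀ i, HasWeakPartial 2 (u i) (w i)}
  zero_mem' := by
    refine ⟨fun φ _ => ?_, fun ψ g _ => ?_, 0, fun i => HasWeakPartial.zero 2⟩
    · exact Finset.sum_eq_zero fun i _ => integral_zero_mul _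
    · exact Finset.sum_eq_zero fun i _ => integral_zero_mul _
  add_mem' := by
    rintro u v ⟨hu, hu', w, hw⟩ ⟨hv, hv', z, hz⟩
    refine ⟨fun φ hφ => ?_, fun ψ g hg => ?_, w + z, fun i => (hw i).add (hz i)⟩
    · rw [← add_zero (0 : ℝ)]
      nth_rewrite 1 [← hu φ hφ]
      rw [← hv φ hφ, ← Finset.sum_add_distrib]
      exact Finset.sum_congr rfl fun i _ => integral_add_mul _ _ (hφ.memLp_partialDeriv i)
    · rw [← add_zero (0 : ℝ)]
      nth_rewrite 1 [← hu' ψ g hg]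
      rw [← hv' ψ g hg, ← Finset.sum_add_distrib]
      exact Finset.sum_congr rfl fun i _ => integral_add_mul _ _ (Lp.memLp (g i))
  smul_mem' := by
    rintro c u ⟨hu, hu', w, hw⟩
    refine ⟨fun φ hφ => ?_, fun ψ g hg => ?_, c • w, fun i => (hw i).smul c⟩
    · rw [← mul_zero c, ← hu φ hφ, Finset.mul_sum]
      exact Finset.sum_congr rfl fun i _ => integral_smul_mul _ _ _
    · rw [← mul_zero c, ← hu' ψ g hg, Finset.mul_sum]
      exact Finset.sum_congr rfl fun i _ => integral_smul_mul _ _ _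

/-- The same space as a type of its own, to carry its own norm (and not that of `L²(Q)³`). -/
def HTilde01 (Ω : TopologicalSpace.Opens Plane) : Type := hTilde01 Ω

namespace HTilde01

variable {Ω : TopologicalSpace.Opens Plane}

instance : AddCommGroup (HTilde01 Ω) := inferInstanceAs (AddCommGroup (hTilde01 Ω))

instance : Module ℝ (HTilde01 Ω) := inferInstanceAs (Module ℝ (hTilde01 Ω))

/-- The inclusion in `L²(Q)³`. -/
def toL2 : HTilde01 Ω →ₗ[ℝ] L2Field (cylinder Ω) := (hTilde01 Ω).subtype

lemma exists_vert (u : HTilde01 Ω) :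
    ∃ w : L2Field (cylinder Ω), ∀ i, HasWeakPartial 2 (toL2 u i) (w i) :=
  u.2.2.2

/-- The vertical derivative `∂₃ u ∈ L²(Q)³`. -/
def vert : HTilde01 Ω →ₗ[ℝ] L2Field (cylinder Ω) where
  toFun u := (exists_vert u).choose
  map_add' u v := by
    ext1 i
    exact ((exists_vert (u + v)).choose_spec i).unique (isOpen_cylinder Ω)
      (((exists_vert u).choose_spec i).add ((exists_vert v).choose_spec i))
  map_smul' c u := by
    ext1 i
    exact ((exists_vert (c • u)).choose_spec i).unique (isOpen_cylinder Ω)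
      (((exists_vert u).choose_spec i).smul c)

lemma hasWeakPartial_vert (u : HTilde01 Ω) (i : Fin 3) :
    HasWeakPartial 2 (toL2 u i) (vert u i) :=
  (exists_vert u).choose_spec i

/-- The embedding `u ↦ (u, ∂₃ u)`. -/
def graph : HTilde01 Ω →ₗ[ℝ] WithLp 2 (L2Field (cylinder Ω) × L2Field (cylinder Ω)) :=
  (WithLp.linearEquiv 2 ℝ (L2Field (cylinder Ω) × L2Field (cylinder Ω))).symm.toLinearMap ∘ₗ
    toL2.prod vert

lemma graph_injective : Function.Injective (graph (Ω := Ω)) := by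
  intro u v h
  exact Subtype.ext (congrArg (fun p => (WithLp.ofLp p).1) h)

instance : NormedAddCommGroup (HTilde01 Ω) :=
  NormedAddCommGroup.induced _ _ (graph (Ω := Ω)) graph_injective

instance : NormedSpace ℝ (HTilde01 Ω) := NormedSpace.induced ℝ _ _ (graph (Ω := Ω))

lemma norm_sq_eq (u : HTilde01 Ω) : ‖u‖ ^ 2 = ‖toL2 u‖ ^ 2 + ‖vert u‖ ^ 2 := by
  change ‖graph u‖ ^ 2 = _
  rw [WithLp.prod_norm_sq_eq_of_L2]
  rfl

end HTilde01

end AnisotropicNS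

end

/-!
# Density of `H̃¹₀(Q)` in `H̃^{0,1}(Q)`

**Inclusion.** For `u ∈ H̃¹₀(Q)` and `ψ ∈ H¹(Q)` the integral of `u · ∇ψ` is integrated by parts
componentwise. The horizontal components vanish on the lateral boundary only, so `∂ⱼψ` (`j = 1, 2`)
has to be tested against functions that do not vanish near the faces; a cutoff in `x₃` alone commutes
with `∂ⱼ` and repairs this (`HasWeakPartial.integral_of_disjoint_lateral`). The roles are exchanged
for the third component (`HasWeakPartial.integral_of_disjoint_faces`).

**Density.** `H̃^{0,1}(Q)` is a Hilbert space, so it suffices that a field `w ∈ H̃^{0,1}(Q)`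
orthogonal to `H̃¹₀(Q)` vanishes. The field is decomposed into its vertical Fourier modes: cosines for
`w_h`, sines for `w₃`.

* Modes `κ = kπ`, `k ≥ 1`. Orthogonality to `(a cos(κx₃), -κ⁻¹ div a sin(κx₃))` with an *arbitrary*
  `a ∈ C_c^∞(Ω)²` says that `-κ (w_h)_k` is the gradient of `(w₃)_k` (`IsOrthogonal.fourier`). Hence
  `(w₃)_k ⊗ cos(κ ·)` is in `H¹(Q)`, and the vanishing of the normal trace of `w`, tested with it,
  reads `‖(w_h)_k‖² + ‖(w₃)_k‖² = 0` (`IsOrthogonal.vertCoeff_eq_zero`).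
* Mode `k = 0`. Orthogonality to `(∂₂φ, -∂₁φ, 0)` says that the vertical mean `A` of `w_h` is
  curl-free in `Ω`, and the normal trace says that `A` is orthogonal to all gradients of `H¹(Ω)`.
  Here star-shapedness enters: by Poincaré's homotopy formula `A - λ A(x₀ + λ (· - x₀))` is, for
  every `λ ∈ (0, 1]`, the gradient of the square-integrable function
  `x ↦ ∫_λ^1 A(x₀ + t (x - x₀)) · (x - x₀) dt`
  (`IsCurlFree.hasPlaneWeakPartial_radialPotential`). In dimension two the norm of
  `λ A(x₀ + λ (· - x₀))` in `L²(Ω)` is that of `A` in `L²(x₀ + λ (Ω - x₀))`, which tends to zero with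
  `λ`. So `A` is a limit of gradients, thus orthogonal to itself (`IsCurlFree.ae_eq_zero`).
-/

noncomputable section

namespace AnisotropicNS

open Filter

variable {Ω : TopologicalSpace.Opens Plane}

/-! ### Cutoff functions -/

/-- Smooth compactly supported cutoffs, equal to `1` in a neighbourhood of a given compact set. -/
lemma exists_cutoff {E : Type*} [NormedAddCommGroup E] [NormedSpace ℝ E] [FiniteDimensional ℝ E]
    {K U : Set E} (hK : IsCompact K) (hU : IsOpen U) (hKU : K ⊆ U) :
    ∃ χ : E → ℝ, ContDiff ℝ ∞ χ ∧ HasCompactSupport χ ∧ tsupport χ ⊆ U ∧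
      (∀ x, χ x ∈ Icc (0 : ℝ) 1) ∧ ∀ x ∈ K, χ =ᶠ[𝓝 x] fun _ => 1 := by
  obtain ⟨L, hL, hKL, hLU⟩ := exists_compact_between hK hU hKU
  obtain ⟨M, hM, hLM, hMU⟩ := exists_compact_between hL hU hLU
  obtain ⟨χ, h1, h2, h3, h4⟩ := exists_contMDiff_support_eq_eq_one_iff (n := (⊤ : ℕ∞))
    (modelWithCornersSelf ℝ E) isOpen_interior hL.isClosed hLM
  have hts : tsupport χ ⊆ M := by
    rw [tsupport, h3]
    exact closure_minimal interior_subset hM.isClosed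
  refine ⟨χ, contMDiff_iff_contDiff.1 h1, hM.of_isClosed_subset (isClosed_tsupport _) hts,
    hts.trans hMU, fun x => h2 ⟨x, rfl⟩, fun x hx => ?_⟩
  filter_upwards [isOpen_interior.mem_nhds (hKL hx)] with y hy
  exact (h4 y).1 (interior_subset hy)

/-- An exhausting sequence of smooth compactly supported cutoffs of an open set. -/
lemma exists_cutoff_seq {E : Type*} [NormedAddCommGroup E] [NormedSpace ℝ E]
    [FiniteDimensional ℝ E] {U : Set E} (hU : IsOpen U) (hb : Bornology.IsBounded U) :
    ∃ χ : ℕ → E → ℝ, (∀ n, ContDiff ℝ ∞ (χ n) ∧ HasCompactSupport (χ n) ∧ tsupport (χ n) ⊆ U ∧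
      ∀ x, χ n x ∈ Icc (0 : ℝ) 1) ∧ ∀ x ∈ U, ∀ᶠ n in atTop, χ n x = 1 := by
  obtain ⟨F, h1, h2, h3, h4⟩ := hU.exists_iUnion_isClosed
  have := FiniteDimensional.proper ℝ E
  choose χ hχ using fun n =>
    exists_cutoff (Metric.isCompact_of_isClosed_isBounded (h1 n) (hb.subset (h2 n))) hU (h2 n)
  refine ⟨χ, fun n => ⟨(hχ n).1, (hχ n).2.1, (hχ n).2.2.1, (hχ n).2.2.2.1⟩, fun x hx => ?_⟩
  rw [← h3] at hx
  obtain ⟨m, hm⟩ := mem_iUnion.1 hx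
  filter_upwards [eventually_ge_atTop m] with n hn
  exact ((hχ n).2.2.2.2 x (h4 hn hm)).eq_of_nhds

/-- Vertical cutoffs `ηₙ ∈ C_c^∞(0,1)` increasing to `1`, with `|ηₙ'(t)| ≤ C / (t (1 - t))`. -/
def vcut (n : ℕ) (t : ℝ) : ℝ := Real.smoothTransition (n * (t * (1 - t)) - 1)

lemma vcut_contDiff (n : ℕ) : ContDiff ℝ ∞ (vcut n) :=
  Real.smoothTransition.contDiff.comp (by fun_prop)

lemma vcut_mem (n : ℕ) (t : ℝ) : vcut n t ∈ Icc (0 : ℝ) 1 :=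
  ⟨Real.smoothTransition.nonneg _, Real.smoothTransition.le_one _⟩

lemma tsupport_vcut_subset (n : ℕ) : tsupport (vcut n) ⊆ Ioo 0 1 := by
  have h1 : tsupport (vcut n) ⊆ {t : ℝ | 1 ≤ n * (t * (1 - t))} := by
    refine closure_minimal (fun t ht => ?_) (isClosed_le continuous_const (by fun_prop))
    by_contra hlt
    exact ht (Real.smoothTransition.zero_of_nonpos (by simp at hlt; linarith))
  intro t ht
  have h2 : (1 : ℝ) ≤ n * (t * (1 - t)) := h1 ht
  have h3 : 0 < t * (1 - t) := by
    by_contra h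
    nlinarith [(Nat.cast_nonneg n : (0 : ℝ) ≤ n)]
  constructor <;> nlinarith

lemma hasCompactSupport_vcut (n : ℕ) : HasCompactSupport (vcut n) :=
  Metric.isCompact_of_isClosed_isBounded (isClosed_tsupport _)
    ((Metric.isBounded_Ioo 0 1).subset (tsupport_vcut_subset n))

lemma vcut_eventually_eq_one {t : ℝ} (ht : t ∈ Ioo (0 : ℝ) 1) :
    ∀ᶠ n in atTop, vcut n =ᶠ[𝓝 t] fun _ => 1 := by
  have hpos : 0 < t * (1 - t) := mul_pos ht.1 (by linarith [ht.2])
  obtain ⟨m, hm⟩ := exists_nat_gt (2 / (t * (1 - t)))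
  filter_upwards [eventually_ge_atTop m] with n hn
  have h1 : (2 : ℝ) < n * (t * (1 - t)) := by
    rw [← div_lt_iff₀ hpos]
    exact hm.trans_le (by exact_mod_cast hn)
  have h2 : ∀ᶠ y in 𝓝 t, (2 : ℝ) < n * (y * (1 - y)) :=
    continuousAt_const.eventually_lt (by fun_prop) h1
  filter_upwards [h2] with y hy
  exact Real.smoothTransition.one_of_one_le (by linarith)

lemma exists_deriv_vcut_bound :
    ∃ C : ℝ, ∀ (n : ℕ) (t : ℝ), t ∈ Ioo (0 : ℝ) 1 → |deriv (vcut n) t| * (t * (1 - t)) ≤ C := by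
  have hc : Continuous (deriv Real.smoothTransition) :=
    (Real.smoothTransition.contDiff (n := 1)).continuous_deriv le_rfl
  obtain ⟨C, hC⟩ := (isCompact_Icc (a := (0 : ℝ)) (b := 1)).exists_bound_of_continuousOn
    (f := fun y => deriv Real.smoothTransition y * (y + 1)) (by fun_prop)
  have hC0 : 0 ≤ C := (norm_nonneg _).trans (hC 0 (by simp))
  have key : ∀ y, |deriv Real.smoothTransition y * (y + 1)| ≤ C := by
    intro y
    by_cases hy : y ∈ Icc (0 : ℝ) 1
    · exact hC y hy
    · have : deriv Real.smoothTransition y = 0 := by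
        rcases lt_or_ge y 0 with h | h
        · have : Real.smoothTransition =ᶠ[𝓝 y] fun _ => 0 := by
            filter_upwards [Iio_mem_nhds h] with z hz
            exact Real.smoothTransition.zero_of_nonpos hz.le
          rw [this.deriv_eq, deriv_const]
        · have h' : 1 < y := by
            by_contra h'
            exact hy ⟨h, not_lt.1 h'⟩
          have : Real.smoothTransition =ᶠ[𝓝 y] fun _ => 1 := by
            filter_upwards [Ioi_mem_nhds h'] with z hz
            exact Real.smoothTransition.one_of_one_le (le_of_lt hz)
          rw [this.deriv_eq, deriv_const]
      simpa [this] using hC0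
  refine ⟨C, fun n t ht => ?_⟩
  have hd : HasDerivAt (vcut n)
      (deriv Real.smoothTransition (n * (t * (1 - t)) - 1) * (n * (1 - 2 * t))) t := by
    have h1 : HasDerivAt (fun t : ℝ => n * (t * (1 - t)) - 1) (n * (1 - 2 * t)) t := by
      have := ((((hasDerivAt_id t).mul ((hasDerivAt_id t).const_sub 1)).const_mul (n : ℝ)).sub_const 1)
      exact this.congr_deriv (by simp only [id]; ring)
    have h2 : HasDerivAt Real.smoothTransition
        (deriv Real.smoothTransition (n * (t * (1 - t)) - 1)) (n * (t * (1 - t)) - 1) :=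
      ((Real.smoothTransition.contDiff (n := 1)).differentiable (by simp)).differentiableAt.hasDerivAt
    exact h2.comp t h1
  have hpos : 0 < t * (1 - t) := mul_pos ht.1 (by linarith [ht.2])
  have h3 : |1 - 2 * t| ≤ 1 := abs_le.2 ⟨by linarith [ht.2], by linarith [ht.1]⟩
  rw [hd.deriv]
  calc _ = |deriv Real.smoothTransition (n * (t * (1 - t)) - 1) *
        (n * (t * (1 - t)) - 1 + 1)| * |1 - 2 * t| := by
        rw [← abs_of_pos hpos, ← abs_mul, ← abs_mul, abs_of_pos hpos]; congr 1; ring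
    _ ≤ C * 1 := mul_le_mul (key _) h3 (abs_nonneg _) hC0
    _ = C := mul_one C

/-! ### Classical calculus on `ℝ² × ℝ` -/

/-- The classical partial derivative of a function on the plane. -/
def planeDeriv (j : Fin 2) (g : Plane → ℝ) (x : Plane) : ℝ :=
  fderiv ℝ g x (EuclideanSpace.single j 1)

/-- Test functions on the plane: `g ∈ C_c^∞(Ω)`. -/
def IsPlaneTest (Ω : Set Plane) (g : Plane → ℝ) : Prop :=
  ContDiff ℝ ∞ g ∧ HasCompactSupport g ∧ tsupport g ⊆ Ω

/-- The function `g ⊗ f : (x_h, x₃) ↦ g(x_h) f(x₃)`. -/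
def tensor (g : Plane → ℝ) (f : ℝ → ℝ) (x : Space) : ℝ := g x.1 * f x.2

lemma dir_castSucc (j : Fin 2) : dir j.castSucc = (EuclideanSpace.single j 1, 0) := by
  fin_cases j <;> rfl

lemma dir_two : dir 2 = (0, 1) := rfl

lemma tensor_contDiff {g : Plane → ℝ} {f : ℝ → ℝ} (hg : ContDiff ℝ ∞ g) (hf : ContDiff ℝ ∞ f) :
    ContDiff ℝ ∞ (tensor g f) :=
  (hg.comp contDiff_fst).mul (hf.comp contDiff_snd)

lemma partialDeriv_contDiff {φ : Space → ℝ} (h : ContDiff ℝ ∞ φ) (i : Fin 3) :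
    ContDiff ℝ ∞ (partialDeriv i φ) :=
  (h.fderiv_right (m := ∞) (by simp)).clm_apply contDiff_const

lemma planeDeriv_contDiff {g : Plane → ℝ} (h : ContDiff ℝ ∞ g) (j : Fin 2) :
    ContDiff ℝ ∞ (planeDeriv j g) :=
  (h.fderiv_right (m := ∞) (by simp)).clm_apply contDiff_const

lemma IsPlaneTest.planeDeriv {Ω : Set Plane} {g : Plane → ℝ} (h : IsPlaneTest Ω g) (j : Fin 2) :
    IsPlaneTest Ω (planeDeriv j g) :=
  ⟨planeDeriv_contDiff h.1 j, h.2.1.fderiv_apply (𝕜 := ℝ) _,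
    (tsupport_fderiv_apply_subset ℝ _).trans h.2.2⟩

lemma hasFDerivAt_tensor {g : Plane → ℝ} {f : ℝ → ℝ} (x : Space) (hg : DifferentiableAt ℝ g x.1)
    (hf : DifferentiableAt ℝ f x.2) :
    HasFDerivAt (tensor g f)
      (g x.1 • (fderiv ℝ f x.2).comp (ContinuousLinearMap.snd ℝ Plane ℝ) +
        f x.2 • (fderiv ℝ g x.1).comp (ContinuousLinearMap.fst ℝ Plane ℝ)) x :=
  (hg.hasFDerivAt.comp x hasFDerivAt_fst).mul (hf.hasFDerivAt.comp x hasFDerivAt_snd)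

lemma partialDeriv_tensor_castSucc {g : Plane → ℝ} {f : ℝ → ℝ} (hg : ContDiff ℝ ∞ g)
    (hf : ContDiff ℝ ∞ f) (j : Fin 2) :
    partialDeriv j.castSucc (tensor g f) = tensor (planeDeriv j g) f := by
  ext x
  rw [partialDeriv, (hasFDerivAt_tensor x (hg.differentiable (by simp)).differentiableAt
    (hf.differentiable (by simp)).differentiableAt).fderiv, dir_castSucc]
  simp [tensor, planeDeriv, mul_comm]

lemma partialDeriv_tensor_two {g : Plane → ℝ} {f : ℝ → ℝ} (hg : ContDiff ℝ ∞ g)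
    (hf : ContDiff ℝ ∞ f) : partialDeriv 2 (tensor g f) = tensor g (deriv f) := by
  ext x
  rw [partialDeriv, (hasFDerivAt_tensor x (hg.differentiable (by simp)).differentiableAt
    (hf.differentiable (by simp)).differentiableAt).fderiv, dir_two]
  simp [tensor]

lemma partialDeriv_mul {φ ψ : Space → ℝ} (hφ : ContDiff ℝ ∞ φ) (hψ : ContDiff ℝ ∞ ψ) (i : Fin 3)
    (x : Space) : partialDeriv i (fun x => φ x * ψ x) x =
      φ x * partialDeriv i ψ x + partialDeriv i φ x * ψ x := by
  have h : HasFDerivAt (fun x => φ x * ψ x) _ x :=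
    (hφ.differentiable (by simp) x).hasFDerivAt.mul (hψ.differentiable (by simp) x).hasFDerivAt
  rw [partialDeriv, h.fderiv]
  simp [partialDeriv, mul_comm]

lemma partialDeriv_congr {φ ψ : Space → ℝ} {x : Space} (h : φ =ᶠ[𝓝 x] ψ) (i : Fin 3) :
    partialDeriv i φ x = partialDeriv i ψ x := by
  rw [partialDeriv, h.fderiv_eq, partialDeriv]

lemma tsupport_tensor_subset (g : Plane → ℝ) (f : ℝ → ℝ) :
    tsupport (tensor g f) ⊆ tsupport g ×ˢ tsupport f := by
  refine closure_minimal (fun x hx => ?_) ((isClosed_tsupport _).prod (isClosed_tsupport _))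
  exact ⟨subset_tsupport _ (left_ne_zero_of_mul hx), subset_tsupport _ (right_ne_zero_of_mul hx)⟩


lemma isTest_tensor {g : Plane → ℝ} {f : ℝ → ℝ} (hg : IsPlaneTest Ω g) (hf : ContDiff ℝ ∞ f)
    (hc : HasCompactSupport f) (hs : tsupport f ⊆ Ioo 0 1) : IsTest (cylinder Ω) (tensor g f) :=
  ⟨tensor_contDiff hg.1 hf,
    (hg.2.1.prod hc).of_isClosed_subset (isClosed_tsupport _) (tsupport_tensor_subset g f),
    (tsupport_tensor_subset g f).trans (prod_mono hg.2.2 hs)⟩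

lemma IsTest.mul_left {Q : Set Space} {φ Φ : Space → ℝ} (h : IsTest Q φ) (hΦ : ContDiff ℝ ∞ Φ) :
    IsTest Q (fun x => Φ x * φ x) :=
  ⟨hΦ.mul h.1, h.2.1.mul_left, (tsupport_mul_subset_right (f := Φ) (g := φ)).trans h.2.2⟩

/-! ### Pairings with bounded functions -/

lemma volume_cylinder_lt_top (hbdd : Bornology.IsBounded (Ω : Set Plane)) :
    volume (cylinder Ω) < ⊤ :=
  (hbdd.prod (Metric.isBounded_Ioo 0 1)).measure_lt_top

lemma memLp_of_bound_cylinder (hbdd : Bornology.IsBounded (Ω : Set Plane)) {φ : Space → ℝ}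
    (hφ : AEStronglyMeasurable φ (volume.restrict (cylinder Ω))) {C : ℝ}
    (hC : ∀ x ∈ cylinder Ω, |φ x| ≤ C) (p : ℝ≥0∞) : MemLp φ p (volume.restrict (cylinder Ω)) := by
  have : IsFiniteMeasure (volume.restrict (cylinder Ω)) :=
    ⟨by rw [Measure.restrict_apply_univ]; exact volume_cylinder_lt_top hbdd⟩
  exact MemLp.of_bound hφ C
    ((ae_restrict_iff' (isOpen_cylinder Ω).measurableSet).2 (ae_of_all _ fun x hx => hC x hx))

lemma exists_bound_cylinder (hbdd : Bornology.IsBounded (Ω : Set Plane)) {φ : Space → ℝ}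
    (hφ : Continuous φ) : ∃ C, ∀ x ∈ cylinder Ω, |φ x| ≤ C := by
  have hb : Bornology.IsBounded (cylinder Ω) := hbdd.prod (Metric.isBounded_Ioo 0 1)
  obtain ⟨C, hC⟩ := hb.isCompact_closure.exists_bound_of_continuousOn hφ.continuousOn
  exact ⟨C, fun x hx => hC x (subset_closure hx)⟩

lemma memLp_of_continuous (hbdd : Bornology.IsBounded (Ω : Set Plane)) {φ : Space → ℝ}
    (hφ : Continuous φ) : MemLp φ 2 (volume.restrict (cylinder Ω)) := by
  obtain ⟨C, hC⟩ := exists_bound_cylinder hbdd hφ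
  exact memLp_of_bound_cylinder hbdd hφ.aestronglyMeasurable hC 2

/-- Bounded pointwise convergence is enough to pass to the limit in pairings with `f ∈ L²(Q)`. -/
lemma tendsto_integral_mul (hbdd : Bornology.IsBounded (Ω : Set Plane)) (f : L2 (cylinder Ω))
    {Φ : ℕ → Space → ℝ} (hc : ∀ n, Continuous (Φ n)) {φ : Space → ℝ} {C : ℝ}
    (hb : ∀ n, ∀ x ∈ cylinder Ω, |Φ n x| ≤ C)
    (ht : ∀ x ∈ cylinder Ω, Tendsto (fun n => Φ n x) atTop (𝓝 (φ x))) :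
    Tendsto (fun n => ∫ x in cylinder Ω, f x * Φ n x) atTop
      (𝓝 (∫ x in cylinder Ω, f x * φ x)) := by
  have : IsFiniteMeasure (volume.restrict (cylinder Ω)) :=
    ⟨by rw [Measure.restrict_apply_univ]; exact volume_cylinder_lt_top hbdd⟩
  have hf : Integrable f (volume.restrict (cylinder Ω)) :=
    (Lp.memLp f).integrable (by norm_num)
  refine tendsto_integral_of_dominated_convergence (fun x => |f x| * C)
    (fun n => hf.1.mul (hc n).aestronglyMeasurable) (hf.abs.mul_const C) (fun n => ?_) ?_
  · refine (ae_restrict_iff' (isOpen_cylinder Ω).measurableSet).2 (ae_of_all _ fun x hx => ?_)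
    rw [norm_mul, Real.norm_eq_abs, Real.norm_eq_abs]
    exact mul_le_mul_of_nonneg_left (hb n x hx) (abs_nonneg _)
  · refine (ae_restrict_iff' (isOpen_cylinder Ω).measurableSet).2 (ae_of_all _ fun x hx => ?_)
    exact (ht x hx).const_mul _

/-! ### Integration by parts for weak derivatives -/

lemma integral_mul_eq_inner {Q : Set Space} (f g : L2 Q) : ∫ x in Q, f x * g x = inner ℝ f g := by
  rw [L2.inner_def]
  simp [mul_comm]

/-- The class in `L²(Q)` of a function that is continuous up to the boundary. -/
def contL2 (hbdd : Bornology.IsBounded (Ω : Set Plane)) {φ : Space → ℝ} (hφ : Continuous φ) :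
    L2 (cylinder Ω) :=
  (memLp_of_continuous hbdd hφ).toLp φ

lemma contL2_ae (hbdd : Bornology.IsBounded (Ω : Set Plane)) {φ : Space → ℝ} (hφ : Continuous φ) :
    contL2 hbdd hφ =ᵐ[volume.restrict (cylinder Ω)] φ :=
  (memLp_of_continuous hbdd hφ).coeFn_toLp

lemma integral_contL2_mul (hbdd : Bornology.IsBounded (Ω : Set Plane)) {φ : Space → ℝ}
    (hφ : Continuous φ) (h : Space → ℝ) :
    ∫ x in cylinder Ω, contL2 hbdd hφ x * h x = ∫ x in cylinder Ω, φ x * h x :=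
  integral_congr_ae (by filter_upwards [contL2_ae hbdd hφ] with x hx; rw [hx])

lemma integral_mul_contL2 (hbdd : Bornology.IsBounded (Ω : Set Plane)) {φ : Space → ℝ}
    (hφ : Continuous φ) (h : Space → ℝ) :
    ∫ x in cylinder Ω, h x * contL2 hbdd hφ x = ∫ x in cylinder Ω, h x * φ x :=
  integral_congr_ae (by filter_upwards [contL2_ae hbdd hφ] with x hx; rw [hx])

lemma hasWeakPartial_contL2 (hbdd : Bornology.IsBounded (Ω : Set Plane)) {φ : Space → ℝ}
    (hφ : ContDiff ℝ ∞ φ) (i : Fin 3) :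
    HasWeakPartial i (contL2 hbdd hφ.continuous)
      (contL2 hbdd (partialDeriv_contDiff hφ i).continuous) := by
  intro ψ hψ
  rw [integral_contL2_mul, integral_contL2_mul]
  have hcψ : HasCompactSupport (partialDeriv i ψ) := hψ.2.1.fderiv_apply (𝕜 := ℝ) (dir i)
  have : (volume : Measure Space).IsAddHaarMeasure :=
    inferInstanceAs ((volume : Measure Plane).prod (volume : Measure ℝ)).IsAddHaarMeasure
  have e := integral_mul_fderiv_eq_neg_fderiv_mul_of_integrable (μ := (volume : Measure Space))
    (f := φ) (g := ψ) (v := dir i)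
    (((partialDeriv_contDiff hφ i).continuous.mul hψ.1.continuous).integrable_of_hasCompactSupport
      hψ.2.1.mul_left)
    ((hφ.continuous.mul (partialDeriv_contDiff hψ.1 i).continuous).integrable_of_hasCompactSupport
      hcψ.mul_left)
    ((hφ.continuous.mul hψ.1.continuous).integrable_of_hasCompactSupport hψ.2.1.mul_left)
    (fun x _ => (hφ.differentiable (by simp)).differentiableAt)
    (fun x _ => (hψ.1.differentiable (by simp)).differentiableAt)
  rw [setIntegral_eq_integral_of_forall_compl_eq_zero,
    setIntegral_eq_integral_of_forall_compl_eq_zero]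
  · exact e
  · intro x hx
    rw [image_eq_zero_of_notMem_tsupport (fun h => hx (hψ.2.2 h)), mul_zero]
  · intro x hx
    have h1 : x ∉ tsupport (partialDeriv i ψ) := fun h =>
      hx (hψ.2.2 (tsupport_fderiv_apply_subset ℝ (dir i) h))
    rw [image_eq_zero_of_notMem_tsupport h1, mul_zero]

/-- The identity defining the weak derivative extends to bounded pointwise limits of test
functions. -/
lemma HasWeakPartial.integral_eq_of_tendsto (hbdd : Bornology.IsBounded (Ω : Set Plane))
    {i : Fin 3} {f g : L2 (cylinder Ω)} (h : HasWeakPartial i f g) {Φ : ℕ → Space → ℝ}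
    (hΦ : ∀ n, IsTest (cylinder Ω) (Φ n)) {φ ψ : Space → ℝ} {C D : ℝ}
    (hC : ∀ n, ∀ x ∈ cylinder Ω, |Φ n x| ≤ C)
    (hD : ∀ n, ∀ x ∈ cylinder Ω, |partialDeriv i (Φ n) x| ≤ D)
    (ht : ∀ x ∈ cylinder Ω, Tendsto (fun n => Φ n x) atTop (𝓝 (φ x)))
    (ht' : ∀ x ∈ cylinder Ω, Tendsto (fun n => partialDeriv i (Φ n) x) atTop (𝓝 (ψ x))) :
    ∫ x in cylinder Ω, f x * ψ x = -∫ x in cylinder Ω, g x * φ x := by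
  have h1 := tendsto_integral_mul hbdd f
    (fun n => (partialDeriv_contDiff (hΦ n).1 i).continuous) hD ht'
  have h2 := (tendsto_integral_mul hbdd g (fun n => (hΦ n).1.continuous) hC ht).neg
  refine tendsto_nhds_unique (h1.congr fun n => ?_) h2
  exact h (Φ n) (hΦ n)

lemma closure_lateral : closure (lateral Ω) = frontier (Ω : Set Plane) ×ˢ Icc (0 : ℝ) 1 := by
  rw [lateral, closure_prod_eq, isClosed_frontier.closure_eq, closure_Ioo (by norm_num)]

lemma closure_faces : closure (faces Ω) = closure (Ω : Set Plane) ×ˢ ({0, 1} : Set ℝ) := by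
  rw [faces, closure_union, closure_prod_eq, closure_prod_eq, closure_singleton,
    closure_singleton, ← prod_union]
  rfl

lemma isCompact_inter_closure_cylinder (hbdd : Bornology.IsBounded (Ω : Set Plane))
    {φ : Space → ℝ} : IsCompact (tsupport φ ∩ closure (Ω : Set Plane) ×ˢ Icc (0 : ℝ) 1) :=
  (hbdd.isCompact_closure.prod isCompact_Icc).inter_left (isClosed_tsupport φ)

/-- A weak horizontal derivative may be tested against smooth functions that vanish near the
lateral boundary only: a cutoff depending on `x₃` alone commutes with horizontal derivatives. -/
lemma HasWeakPartial.integral_of_disjoint_lateral (hbdd : Bornology.IsBounded (Ω : Set Plane))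
    {j : Fin 2} {f g : L2 (cylinder Ω)} (h : HasWeakPartial j.castSucc f g) {φ : Space → ℝ}
    (hφ : ContDiff ℝ ∞ φ) (hd : Disjoint (tsupport φ) (closure (lateral Ω))) :
    ∫ x in cylinder Ω, f x * partialDeriv j.castSucc φ x = -∫ x in cylinder Ω, g x * φ x := by
  set K := Prod.fst '' (tsupport φ ∩ closure (Ω : Set Plane) ×ˢ Icc (0 : ℝ) 1) with hKdef
  have hK : IsCompact K := (isCompact_inter_closure_cylinder hbdd).image continuous_fst
  have hKΩ : K ⊆ Ω := by
    rintro _ ⟨x, ⟨hx1, hx2, hx3⟩, rfl⟩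
    by_contra hx
    refine disjoint_left.1 hd hx1 ?_
    rw [closure_lateral]
    exact ⟨⟨hx2, fun h' => hx (interior_subset h')⟩, hx3⟩
  obtain ⟨χ, h1, h2, h3, h4, h5⟩ := exists_cutoff hK Ω.isOpen hKΩ
  have hsm : ∀ n, ContDiff ℝ ∞ (tensor (fun _ => (1 : ℝ)) (vcut n)) := fun n =>
    tensor_contDiff contDiff_const (vcut_contDiff n)
  have heq : ∀ n, ∀ x ∈ cylinder Ω, (fun x => φ x * tensor χ (vcut n) x) =ᶠ[𝓝 x]
      fun x => φ x * tensor (fun _ => 1) (vcut n) x := by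
    intro n x hx
    by_cases hxs : x ∈ tsupport φ
    · have hxK : x.1 ∈ K := ⟨x, ⟨hxs, subset_closure hx.1, Ioo_subset_Icc_self hx.2⟩, rfl⟩
      filter_upwards [(h5 x.1 hxK).comp_tendsto continuousAt_fst] with y hy
      simp only [Function.comp] at hy
      simp [tensor, hy]
    · filter_upwards [notMem_tsupport_iff_eventuallyEq.1 hxs] with y hy
      simp [hy]
  have hpd : ∀ n, ∀ x ∈ cylinder Ω,
      partialDeriv j.castSucc (fun x => φ x * tensor χ (vcut n) x) x =
        partialDeriv j.castSucc φ x * vcut n x.2 := by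
    intro n x hx
    rw [partialDeriv_congr (heq n x hx), partialDeriv_mul hφ (hsm n),
      partialDeriv_tensor_castSucc contDiff_const (vcut_contDiff n)]
    simp [tensor, planeDeriv]
  obtain ⟨C, hC⟩ := exists_bound_cylinder hbdd hφ.continuous
  obtain ⟨D, hD⟩ := exists_bound_cylinder hbdd (partialDeriv_contDiff hφ j.castSucc).continuous
  have hlim : ∀ x ∈ cylinder Ω, ∀ c : ℝ, Tendsto (fun n => c * vcut n x.2) atTop (𝓝 c) := by
    intro x hx c
    refine tendsto_const_nhds.congr' ?_
    filter_upwards [vcut_eventually_eq_one hx.2] with n hn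
    rw [hn.eq_of_nhds, mul_one]
  have hval : ∀ n, ∀ x ∈ cylinder Ω, φ x * tensor χ (vcut n) x = φ x * vcut n x.2 := by
    intro n x hx
    rw [(heq n x hx).eq_of_nhds]
    simp [tensor]
  have hle : ∀ n (x : Space) (c : ℝ), |c * vcut n x.2| ≤ |c| := fun n x c => by
    rw [abs_mul, abs_of_nonneg (vcut_mem n _).1]
    exact mul_le_of_le_one_right (abs_nonneg _) (vcut_mem n _).2
  refine h.integral_eq_of_tendsto hbdd (C := C) (D := D)
    (Φ := fun n x => φ x * tensor χ (vcut n) x)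
    (fun n => (isTest_tensor ⟨h1, h2, h3⟩ (vcut_contDiff n) (hasCompactSupport_vcut n)
      (tsupport_vcut_subset n)).mul_left hφ) ?_ ?_ ?_ ?_
  · intro n x hx
    rw [hval n x hx]
    exact (hle n x _).trans (hC x hx)
  · intro n x hx
    rw [hpd n x hx]
    exact (hle n x _).trans (hD x hx)
  · intro x hx
    simp only [hval _ x hx]
    exact hlim x hx _
  · intro x hx
    simp only [hpd _ x hx]
    exact hlim x hx _

/-- A weak vertical derivative may be tested against smooth functions that vanish near the
horizontal faces only: a cutoff depending on `x_h` alone commutes with `∂₃`. -/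
lemma HasWeakPartial.integral_of_disjoint_faces (hbdd : Bornology.IsBounded (Ω : Set Plane))
    {f g : L2 (cylinder Ω)} (h : HasWeakPartial 2 f g) {φ : Space → ℝ}
    (hφ : ContDiff ℝ ∞ φ) (hd : Disjoint (tsupport φ) (closure (faces Ω))) :
    ∫ x in cylinder Ω, f x * partialDeriv 2 φ x = -∫ x in cylinder Ω, g x * φ x := by
  set K := Prod.snd '' (tsupport φ ∩ closure (Ω : Set Plane) ×ˢ Icc (0 : ℝ) 1) with hKdef
  have hK : IsCompact K := (isCompact_inter_closure_cylinder hbdd).image continuous_snd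
  have hKI : K ⊆ Ioo 0 1 := by
    rintro _ ⟨x, ⟨hx1, hx2, hx3⟩, rfl⟩
    by_contra hx
    refine disjoint_left.1 hd hx1 ?_
    rw [closure_faces]
    refine ⟨hx2, ?_⟩
    by_contra h'
    simp only [mem_insert_iff, mem_singleton_iff, not_or] at h'
    exact hx ⟨lt_of_le_of_ne hx3.1 (Ne.symm h'.1), lt_of_le_of_ne hx3.2 h'.2⟩
  obtain ⟨η, h1, h2, h3, h4, h5⟩ := exists_cutoff hK isOpen_Ioo hKI
  obtain ⟨χ, hχ, hχ1⟩ := exists_cutoff_seq Ω.isOpen hbdd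
  have heq : ∀ n, ∀ x ∈ cylinder Ω, (fun x => φ x * tensor (χ n) η x) =ᶠ[𝓝 x]
      fun x => φ x * tensor (χ n) (fun _ => 1) x := by
    intro n x hx
    by_cases hxs : x ∈ tsupport φ
    · have hxK : x.2 ∈ K := ⟨x, ⟨hxs, subset_closure hx.1, Ioo_subset_Icc_self hx.2⟩, rfl⟩
      filter_upwards [(h5 x.2 hxK).comp_tendsto continuousAt_snd] with y hy
      simp only [Function.comp] at hy
      simp [tensor, hy]
    · filter_upwards [notMem_tsupport_iff_eventuallyEq.1 hxs] with y hy
      simp [hy]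
  have hpd : ∀ n, ∀ x ∈ cylinder Ω,
      partialDeriv 2 (fun x => φ x * tensor (χ n) η x) x = partialDeriv 2 φ x * χ n x.1 := by
    intro n x hx
    rw [partialDeriv_congr (heq n x hx), partialDeriv_mul hφ
      (tensor_contDiff (hχ n).1 contDiff_const), partialDeriv_tensor_two (hχ n).1 contDiff_const]
    simp [tensor]
  obtain ⟨C, hC⟩ := exists_bound_cylinder hbdd hφ.continuous
  obtain ⟨D, hD⟩ := exists_bound_cylinder hbdd (partialDeriv_contDiff hφ 2).continuous
  have hlim : ∀ x ∈ cylinder Ω, ∀ c : ℝ, Tendsto (fun n => c * χ n x.1) atTop (𝓝 c) := by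
    intro x hx c
    refine tendsto_const_nhds.congr' ?_
    filter_upwards [hχ1 x.1 hx.1] with n hn
    rw [hn, mul_one]
  have hval : ∀ n, ∀ x ∈ cylinder Ω, φ x * tensor (χ n) η x = φ x * χ n x.1 := by
    intro n x hx
    rw [(heq n x hx).eq_of_nhds]
    simp [tensor]
  have hle : ∀ n (x : Space) (c : ℝ), |c * χ n x.1| ≤ |c| := fun n x c => by
    rw [abs_mul, abs_of_nonneg ((hχ n).2.2.2 _).1]
    exact mul_le_of_le_one_right (abs_nonneg _) ((hχ n).2.2.2 _).2
  refine h.integral_eq_of_tendsto hbdd (C := C) (D := D)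
    (Φ := fun n x => φ x * tensor (χ n) η x)
    (fun n => (isTest_tensor ⟨(hχ n).1, (hχ n).2.1, (hχ n).2.2.1⟩ h1 h2 h3).mul_left hφ)
    ?_ ?_ ?_ ?_
  · intro n x hx
    rw [hval n x hx]
    exact (hle n x _).trans (hC x hx)
  · intro n x hx
    rw [hpd n x hx]
    exact (hle n x _).trans (hD x hx)
  · intro x hx
    simp only [hval _ x hx]
    exact hlim x hx _
  · intro x hx
    simp only [hpd _ x hx]
    exact hlim x hx _

/-- For vertical profiles `s` vanishing linearly at `0` and `1`, the cut-off profiles `s ηₙ` converge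
to `s` boundedly together with their derivatives. -/
lemma exists_vcut_mul_bounds {s : ℝ → ℝ} (hs : ContDiff ℝ ∞ s) {M : ℝ}
    (hM : ∀ t ∈ Ioo (0 : ℝ) 1, |s t| ≤ M * (t * (1 - t))) :
    ∃ D : ℝ, (∀ n, ∀ t ∈ Ioo (0 : ℝ) 1,
        |s t * vcut n t| ≤ D ∧ |deriv (fun t => s t * vcut n t) t| ≤ D) ∧
      ∀ t ∈ Ioo (0 : ℝ) 1, ∀ᶠ n in atTop,
        s t * vcut n t = s t ∧ deriv (fun t => s t * vcut n t) t = deriv s t := by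
  obtain ⟨C, hC⟩ := exists_deriv_vcut_bound
  have hcd : Continuous (deriv s) := hs.continuous_deriv (by simp)
  obtain ⟨A, hA⟩ := isCompact_Icc.exists_bound_of_continuousOn (s := Icc (0 : ℝ) 1)
    hs.continuous.continuousOn
  obtain ⟨B, hB⟩ := isCompact_Icc.exists_bound_of_continuousOn (s := Icc (0 : ℝ) 1)
    hcd.continuousOn
  refine ⟨max A (M * C + B), fun n t ht => ⟨?_, ?_⟩, fun t ht => ?_⟩
  · rw [abs_mul, abs_of_nonneg (vcut_mem n t).1]
    exact (mul_le_of_le_one_right (abs_nonneg _) (vcut_mem n t).2).trans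
      ((hA t (Ioo_subset_Icc_self ht)).trans (le_max_left _ _))
  · have hd : HasDerivAt (fun t => s t * vcut n t)
        (deriv s t * vcut n t + s t * deriv (vcut n) t) t :=
      (hs.differentiable (by simp)).differentiableAt.hasDerivAt.mul
        ((vcut_contDiff n).differentiable (by simp)).differentiableAt.hasDerivAt
    have hpos : 0 < t * (1 - t) := mul_pos ht.1 (by linarith [ht.2])
    have hM0 : 0 ≤ M := by
      by_contra h
      nlinarith [hM t ht, abs_nonneg (s t)]
    rw [hd.deriv]
    refine le_trans ?_ (le_max_right _ _)
    have h1 : |s t * deriv (vcut n) t| ≤ M * C := by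
      rw [abs_mul]
      calc _ ≤ M * (t * (1 - t)) * |deriv (vcut n) t| :=
            mul_le_mul_of_nonneg_right (hM t ht) (abs_nonneg _)
        _ = M * (|deriv (vcut n) t| * (t * (1 - t))) := by ring
        _ ≤ M * C := mul_le_mul_of_nonneg_left (hC n t ht) hM0
    have h2 : |deriv s t * vcut n t| ≤ B := by
      rw [abs_mul, abs_of_nonneg (vcut_mem n t).1]
      exact (mul_le_of_le_one_right (abs_nonneg _) (vcut_mem n t).2).trans
        (hB t (Ioo_subset_Icc_self ht))
    linarith [abs_add_le (deriv s t * vcut n t) (s t * deriv (vcut n) t)]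
  · filter_upwards [vcut_eventually_eq_one ht] with n hn
    refine ⟨by rw [hn.eq_of_nhds, mul_one], Filter.EventuallyEq.deriv_eq ?_⟩
    filter_upwards [hn] with y hy
    rw [hy, mul_one]

/-- A weak vertical derivative may be tested against `g ⊗ s` when `s` vanishes at `0` and `1`. -/
lemma HasWeakPartial.integral_tensor (hbdd : Bornology.IsBounded (Ω : Set Plane))
    {f f' : L2 (cylinder Ω)} (h : HasWeakPartial 2 f f') {g : Plane → ℝ} (hg : IsPlaneTest Ω g)
    {s : ℝ → ℝ} (hs : ContDiff ℝ ∞ s) {M : ℝ}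
    (hM : ∀ t ∈ Ioo (0 : ℝ) 1, |s t| ≤ M * (t * (1 - t))) :
    ∫ x in cylinder Ω, f x * tensor g (deriv s) x =
      -∫ x in cylinder Ω, f' x * tensor g s x := by
  obtain ⟨D, hD, ht⟩ := exists_vcut_mul_bounds hs hM
  obtain ⟨G, hG⟩ := hg.2.1.exists_bound_of_continuous hg.1.continuous
  have hG0 : 0 ≤ G := (norm_nonneg _).trans (hG 0)
  have hsm : ∀ n, ContDiff ℝ ∞ (fun t => s t * vcut n t) := fun n => hs.mul (vcut_contDiff n)
  refine h.integral_eq_of_tendsto hbdd (Φ := fun n => tensor g (fun t => s t * vcut n t))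
    (C := G * D) (D := G * D) (fun n => isTest_tensor hg (hsm n)
      (hasCompactSupport_vcut n).mul_left
      ((tsupport_mul_subset_right (f := s)).trans (tsupport_vcut_subset n))) ?_ ?_ ?_ ?_
  · intro n x hx
    rw [tensor, abs_mul]
    exact mul_le_mul (hG _) (hD n _ hx.2).1 (abs_nonneg _) hG0
  · intro n x hx
    rw [partialDeriv_tensor_two hg.1 (hsm n), tensor, abs_mul]
    exact mul_le_mul (hG _) (hD n _ hx.2).2 (abs_nonneg _) hG0
  · intro x hx
    refine tendsto_const_nhds.congr' ?_
    filter_upwards [ht _ hx.2] with n hn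
    simp only [tensor, hn.1]
  · intro x hx
    refine tendsto_const_nhds.congr' ?_
    filter_upwards [ht _ hx.2] with n hn
    rw [partialDeriv_tensor_two hg.1 (hsm n)]
    simp only [tensor, hn.2]

/-! ### The space `H̃¹₀(Q)` -/

lemma norm_sub_contL2_lt_iff (hbdd : Bornology.IsBounded (Ω : Set Plane)) (f : L2 (cylinder Ω))
    {φ : Space → ℝ} (hφ : Continuous φ) {ε : ℝ} :
    ‖f - contL2 hbdd hφ‖ < ε ↔
      eLpNorm (fun x => f x - φ x) 2 (volume.restrict (cylinder Ω)) < ENNReal.ofReal ε := by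
  have h : eLpNorm (f - contL2 hbdd hφ : L2 (cylinder Ω)) 2 (volume.restrict (cylinder Ω)) =
      eLpNorm (fun x => f x - φ x) 2 (volume.restrict (cylinder Ω)) := by
    refine eLpNorm_congr_ae ?_
    filter_upwards [Lp.coeFn_sub f (contL2 hbdd hφ), contL2_ae hbdd hφ] with x h1 h2
    rw [h1, Pi.sub_apply, h2]
  rw [Lp.norm_def, ← ENNReal.lt_ofReal_iff_toReal_lt (Lp.eLpNorm_ne_top _), h]

/-- Vanishing on a part of the boundary in terms of the norm of `L²(Q)`. -/
lemma vanishesOn_iff (hbdd : Bornology.IsBounded (Ω : Set Plane)) {Γ : Set Space}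
    {f : L2 (cylinder Ω)} :
    VanishesOn Γ f ↔ ∃ g : Fin 3 → L2 (cylinder Ω), (∀ i, HasWeakPartial i f (g i)) ∧
      ∀ ε : ℝ, 0 < ε → ∃ (φ : Space → ℝ) (hφ : ContDiff ℝ ∞ φ),
        Disjoint (tsupport φ) (closure Γ) ∧ ‖f - contL2 hbdd hφ.continuous‖ < ε ∧
        ∀ i, ‖g i - contL2 hbdd (partialDeriv_contDiff hφ i).continuous‖ < ε := by
  refine exists_congr fun g => and_congr_right fun _ => ⟨fun h ε hε => ?_, fun h ε hε => ?_⟩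
  · obtain ⟨φ, h1, h2, h3, h4⟩ := h (ENNReal.ofReal ε) (ENNReal.ofReal_pos.2 hε)
    exact ⟨φ, h1, h2, (norm_sub_contL2_lt_iff hbdd f h1.continuous).2 h3, fun i =>
      (norm_sub_contL2_lt_iff hbdd _ (partialDeriv_contDiff h1 i).continuous).2 (h4 i)⟩
  · have hm : 0 < min ε 1 := lt_min hε one_pos
    have hm' : min ε 1 ≠ ⊤ := ((min_le_right _ _).trans_lt ENNReal.one_lt_top).ne
    obtain ⟨φ, h1, h2, h3, h4⟩ := h (min ε 1).toReal (ENNReal.toReal_pos hm.ne' hm')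
    rw [norm_sub_contL2_lt_iff, ENNReal.ofReal_toReal hm'] at h3
    refine ⟨φ, h1, h2, h3.trans_le (min_le_left _ _), fun i => ?_⟩
    have := h4 i
    rw [norm_sub_contL2_lt_iff, ENNReal.ofReal_toReal hm'] at this
    exact this.trans_le (min_le_left _ _)

lemma contL2_add (hbdd : Bornology.IsBounded (Ω : Set Plane)) {φ ψ : Space → ℝ}
    (hφ : Continuous φ) (hψ : Continuous ψ) {χ : Space → ℝ} (hχ : Continuous χ)
    (h : ∀ x, χ x = φ x + ψ x) :
    contL2 hbdd hχ = contL2 hbdd hφ + contL2 hbdd hψ := by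
  obtain rfl : χ = φ + ψ := funext h
  exact MemLp.toLp_add _ _

lemma contL2_smul (hbdd : Bornology.IsBounded (Ω : Set Plane)) {φ : Space → ℝ}
    (hφ : Continuous φ) (c : ℝ) {χ : Space → ℝ} (hχ : Continuous χ) (h : ∀ x, χ x = c * φ x) :
    contL2 hbdd hχ = c • contL2 hbdd hφ := by
  obtain rfl : χ = c • φ := funext h
  exact MemLp.toLp_const_smul _ _

lemma partialDeriv_add {φ ψ : Space → ℝ} (hφ : ContDiff ℝ ∞ φ) (hψ : ContDiff ℝ ∞ ψ) (i : Fin 3)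
    (x : Space) : partialDeriv i (φ + ψ) x = partialDeriv i φ x + partialDeriv i ψ x := by
  rw [partialDeriv, ((hφ.differentiable (by simp) x).hasFDerivAt.add
    (hψ.differentiable (by simp) x).hasFDerivAt).fderiv]
  rfl

lemma partialDeriv_smul {φ : Space → ℝ} (hφ : ContDiff ℝ ∞ φ) (c : ℝ) (i : Fin 3)
    (x : Space) : partialDeriv i (c • φ) x = c * partialDeriv i φ x := by
  rw [partialDeriv, ((hφ.differentiable (by simp) x).hasFDerivAt.const_smul c).fderiv]
  rfl

lemma VanishesOn.add (hbdd : Bornology.IsBounded (Ω : Set Plane)) {Γ : Set Space}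
    {f f' : L2 (cylinder Ω)} (h : VanishesOn Γ f) (h' : VanishesOn Γ f') :
    VanishesOn Γ (f + f') := by
  rw [vanishesOn_iff hbdd] at h h' ⊢
  obtain ⟨g, hg, ha⟩ := h
  obtain ⟨g', hg', ha'⟩ := h'
  refine ⟨g + g', fun i => (hg i).add (hg' i), fun ε hε => ?_⟩
  obtain ⟨φ, h1, h2, h3, h4⟩ := ha (ε / 2) (half_pos hε)
  obtain ⟨φ', h1', h2', h3', h4'⟩ := ha' (ε / 2) (half_pos hε)
  refine ⟨φ + φ', h1.add h1', ?_, ?_, fun i => ?_⟩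
  · exact (h2.union_left h2').mono_left (tsupport_add φ φ')
  · rw [contL2_add hbdd h1.continuous h1'.continuous _ fun _ => rfl, add_sub_add_comm]
    linarith [norm_add_le (f - contL2 hbdd h1.continuous) (f' - contL2 hbdd h1'.continuous)]
  · rw [contL2_add hbdd (partialDeriv_contDiff h1 i).continuous
      (partialDeriv_contDiff h1' i).continuous _ (partialDeriv_add h1 h1' i), Pi.add_apply,
      add_sub_add_comm]
    linarith [norm_add_le (g i - contL2 hbdd (partialDeriv_contDiff h1 i).continuous)
      (g' i - contL2 hbdd (partialDeriv_contDiff h1' i).continuous), h4 i, h4' i]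

lemma VanishesOn.smul (hbdd : Bornology.IsBounded (Ω : Set Plane)) {Γ : Set Space}
    {f : L2 (cylinder Ω)} (c : ℝ) (h : VanishesOn Γ f) : VanishesOn Γ (c • f) := by
  rw [vanishesOn_iff hbdd] at h ⊢
  obtain ⟨g, hg, ha⟩ := h
  have hc : 0 < |c| + 1 := by positivity
  refine ⟨fun i => c • g i, fun i => (hg i).smul c, fun ε hε => ?_⟩
  obtain ⟨φ, h1, h2, h3, h4⟩ := ha (ε / (|c| + 1)) (by positivity)
  have key : ∀ v : L2 (cylinder Ω), ‖v‖ < ε / (|c| + 1) → ‖c • v‖ < ε := fun v hv => by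
    rw [lt_div_iff₀ hc] at hv
    rw [norm_smul, Real.norm_eq_abs]
    nlinarith [norm_nonneg v]
  refine ⟨c • φ, h1.const_smul c, ?_, ?_, fun i => ?_⟩
  · exact h2.mono_left (closure_mono (Function.support_const_smul_subset c φ))
  · rw [contL2_smul hbdd h1.continuous c _ fun _ => rfl, ← smul_sub]
    exact key _ h3
  · rw [contL2_smul hbdd (partialDeriv_contDiff h1 i).continuous c _ (partialDeriv_smul h1 c i),
      ← smul_sub]
    exact key _ (h4 i)

lemma VanishesOn.zero (Γ : Set Space) : VanishesOn Γ (0 : L2 (cylinder Ω)) := by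
  refine ⟨0, fun i => HasWeakPartial.zero i, fun ε hε => ⟨0, contDiff_const, ?_, ?_, fun i => ?_⟩⟩
  · simp [tsupport]
  · rwa [eLpNorm_congr_ae (g := 0), eLpNorm_zero]
    filter_upwards [Lp.coeFn_zero ℝ 2 (volume.restrict (cylinder Ω))] with x hx
    change (0 : L2 (cylinder Ω)) x - 0 = 0
    rw [hx, Pi.zero_apply, sub_zero]
  · rwa [eLpNorm_congr_ae (g := 0), eLpNorm_zero]
    filter_upwards [Lp.coeFn_zero ℝ 2 (volume.restrict (cylinder Ω))] with x hx
    change (0 : L2 (cylinder Ω)) x - partialDeriv i 0 x = 0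
    rw [hx]
    simp [partialDeriv]

/-- The fields of `H̃^{0,1}(Q)` that lie in `H̃¹₀(Q)`, as a subspace. -/
def hTilde10 (hbdd : Bornology.IsBounded (Ω : Set Plane)) : Submodule ℝ (HTilde01 Ω) where
  carrier := {u | HTilde01.toL2 u ∈ HTilde10 Ω}
  zero_mem' := by
    have h0 := (hTilde01 Ω).zero_mem
    exact ⟨fun i j => ⟨0, HasWeakPartial.zero j⟩, h0.1, fun i => VanishesOn.zero _,
      VanishesOn.zero _⟩
  add_mem' := by
    intro u v hu hv
    refine ⟨fun i j => ?_, (u + v).2.1, fun i => (hu.2.2.1 i).add hbdd (hv.2.2.1 i),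
      hu.2.2.2.add hbdd hv.2.2.2⟩
    obtain ⟨g, hg⟩ := hu.1 i j
    obtain ⟨g', hg'⟩ := hv.1 i j
    exact ⟨g + g', hg.add hg'⟩
  smul_mem' := by
    intro c u hu
    refine ⟨fun i j => ?_, (c • u).2.1, fun i => (hu.2.2.1 i).smul hbdd c,
      hu.2.2.2.smul hbdd c⟩
    obtain ⟨g, hg⟩ := hu.1 i j
    exact ⟨c • g, hg.smul c⟩

/-- If smooth functions vanishing near `Γ` are admissible against the weak derivative `f' = ∂ᵢ f`,
so are the `H¹` functions vanishing on `Γ`. -/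
lemma HasWeakPartial.integral_of_vanishesOn (hbdd : Bornology.IsBounded (Ω : Set Plane))
    {Γ : Set Space} {i : Fin 3} {f f' : L2 (cylinder Ω)}
    (htest : ∀ φ : Space → ℝ, ContDiff ℝ ∞ φ → Disjoint (tsupport φ) (closure Γ) →
      ∫ x in cylinder Ω, f x * partialDeriv i φ x = -∫ x in cylinder Ω, f' x * φ x)
    {u u' : L2 (cylinder Ω)} (hu : VanishesOn Γ u) (hu' : HasWeakPartial i u u') :
    ∫ x in cylinder Ω, u x * f' x = -∫ x in cylinder Ω, u' x * f x := by
  rw [vanishesOn_iff hbdd] at hu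
  obtain ⟨G, hG, ha⟩ := hu
  obtain rfl := hu'.unique (isOpen_cylinder Ω) (hG i)
  rw [integral_mul_eq_inner, integral_mul_eq_inner, ← add_eq_zero_iff_eq_neg]
  set d := inner ℝ u f' + inner ℝ (G i) f with hd
  set S := ‖f'‖ + ‖f‖ with hS
  have hS0 : 0 ≤ S := by positivity
  have key : ∀ ε : ℝ, 0 < ε → |d| ≤ ε * S := by
    intro ε hε
    obtain ⟨φ, h1, h2, h3, h4⟩ := ha ε hε
    have e := htest φ h1 h2
    rw [← integral_mul_contL2 hbdd h1.continuous,
      ← integral_mul_contL2 hbdd (partialDeriv_contDiff h1 i).continuous,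
      integral_mul_eq_inner, integral_mul_eq_inner, real_inner_comm, real_inner_comm _ f'] at e
    have e2 : d = inner ℝ (u - contL2 hbdd h1.continuous) f' +
        inner ℝ (G i - contL2 hbdd (partialDeriv_contDiff h1 i).continuous) f := by
      rw [inner_sub_left, inner_sub_left, hd]
      linarith
    have e3 := abs_real_inner_le_norm (u - contL2 hbdd h1.continuous) f'
    have e4 := abs_real_inner_le_norm
      (G i - contL2 hbdd (partialDeriv_contDiff h1 i).continuous) f
    have e5 := mul_le_mul_of_nonneg_right h3.le (norm_nonneg f')
    have e6 := mul_le_mul_of_nonneg_right (h4 i).le (norm_nonneg f)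
    rw [e2, hS, mul_add]
    exact (abs_add_le _ _).trans (by linarith)
  by_contra hne
  have hpos : 0 < |d| := abs_pos.2 hne
  have := key (|d| / (2 * (S + 1))) (by positivity)
  rw [div_mul_eq_mul_div, le_div_iff₀ (by positivity)] at this
  nlinarith

lemma sum_eq_zero_of_isDivFree {u : L2Field (cylinder Ω)} (hu : IsDivFree u)
    {g : Fin 3 → L2 (cylinder Ω)} (hg : ∀ i, HasWeakPartial i (u i) (g i)) : ∑ i, g i = 0 := by
  have h : HasWeakPartial 0 (0 : L2 (cylinder Ω)) (∑ i, g i) := by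
    intro φ hφ
    rw [integral_zero_mul, zero_eq_neg, Fin.sum_univ_three, integral_add_mul _ _ hφ.memLp,
      integral_add_mul _ _ hφ.memLp]
    have h0 := hu φ hφ
    rw [Fin.sum_univ_three, hg 0 φ hφ, hg 1 φ hφ, hg 2 φ hφ] at h0
    linarith
  exact h.unique (isOpen_cylinder Ω) (HasWeakPartial.zero 0)

/-- The fields of `H̃¹₀(Q)` have zero normal trace: integrate `u · ∇ψ` by parts, using `u_h = 0` on
the lateral boundary and `u₃ = 0` on the faces. -/
lemma HTilde10.normalTraceEqZero (hbdd : Bornology.IsBounded (Ω : Set Plane))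
    {u : L2Field (cylinder Ω)} (hu : u ∈ HTilde10 Ω) : NormalTraceEqZero u := by
  obtain ⟨h1, hdiv, hlat, hfac⟩ := hu
  intro ψ g hg
  choose u' hu' using fun i => h1 i i
  have e : ∀ i, ∫ x in cylinder Ω, u i x * g i x = -∫ x in cylinder Ω, u' i x * ψ x := by
    intro i
    refine Fin.lastCases ?_ (fun j => ?_) i
    · exact HasWeakPartial.integral_of_vanishesOn hbdd
        (fun φ hφ hd => (hg 2).integral_of_disjoint_faces hbdd hφ hd) hfac (hu' 2)
    · exact HasWeakPartial.integral_of_vanishesOn hbdd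
        (fun φ hφ hd => (hg j.castSucc).integral_of_disjoint_lateral hbdd hφ hd)
        (hlat j.castSucc) (hu' j.castSucc)
  simp only [e, integral_mul_eq_inner]
  rw [Finset.sum_neg_distrib, ← sum_inner, sum_eq_zero_of_isDivFree hdiv hu', inner_zero_left,
    neg_zero]

lemma HTilde10.mem_hTilde01 (hbdd : Bornology.IsBounded (Ω : Set Plane))
    {u : L2Field (cylinder Ω)} (hu : u ∈ HTilde10 Ω) : u ∈ hTilde01 Ω := by
  choose w hw using fun i => hu.1 i 2
  exact ⟨hu.2.1, HTilde10.normalTraceEqZero hbdd hu, WithLp.toLp 2 w, hw⟩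

/-! ### Smooth product fields -/

lemma tendsto_contL2 (hbdd : Bornology.IsBounded (Ω : Set Plane)) {Φ : ℕ → Space → ℝ}
    (hc : ∀ n, Continuous (Φ n)) {φ : Space → ℝ} (hφ : Continuous φ) {C : ℝ}
    (hb : ∀ n, ∀ x ∈ cylinder Ω, |Φ n x| ≤ C)
    (ht : ∀ x ∈ cylinder Ω, ∀ᶠ n in atTop, Φ n x = φ x) :
    Tendsto (fun n => ‖contL2 hbdd hφ - contL2 hbdd (hc n)‖) atTop (𝓝 0) := by
  have : IsFiniteMeasure (volume.restrict (cylinder Ω)) :=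
    ⟨by rw [Measure.restrict_apply_univ]; exact volume_cylinder_lt_top hbdd⟩
  obtain ⟨B, hB⟩ := exists_bound_cylinder hbdd hφ
  have h1 : Tendsto (fun n => ∫ x in cylinder Ω, (φ x - Φ n x) ^ 2) atTop (𝓝 0) := by
    rw [← integral_zero Space ℝ (μ := volume.restrict (cylinder Ω))]
    refine tendsto_integral_of_dominated_convergence (fun _ => (B + C) ^ 2)
      (fun n => ((hφ.sub (hc n)).pow 2).aestronglyMeasurable) (integrable_const _)
      (fun n => ?_) ?_
    · refine (ae_restrict_iff' (isOpen_cylinder Ω).measurableSet).2 (ae_of_all _ fun x hx => ?_)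
      rw [norm_pow, Real.norm_eq_abs]
      exact pow_le_pow_left₀ (abs_nonneg _)
        ((abs_sub _ _).trans (add_le_add (hB x hx) (hb n x hx))) 2
    · refine (ae_restrict_iff' (isOpen_cylinder Ω).measurableSet).2 (ae_of_all _ fun x hx => ?_)
      refine tendsto_const_nhds.congr' ?_
      filter_upwards [ht x hx] with n hn
      simp [hn]
  have h2 : ∀ n, ∫ x in cylinder Ω, (φ x - Φ n x) ^ 2 =
      ‖contL2 hbdd hφ - contL2 hbdd (hc n)‖ ^ 2 := by
    intro n
    rw [← real_inner_self_eq_norm_sq, ← integral_mul_eq_inner]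
    refine integral_congr_ae ?_
    filter_upwards [Lp.coeFn_sub (contL2 hbdd hφ) (contL2 hbdd (hc n)), contL2_ae hbdd hφ,
      contL2_ae hbdd (hc n)] with x e1 e2 e3
    rw [e1, Pi.sub_apply, e2, e3, sq]
  simp only [h2] at h1
  have h3 := h1.sqrt
  simpa [Real.sqrt_sq] using h3

lemma vanishesOn_lateral_tensor (hbdd : Bornology.IsBounded (Ω : Set Plane)) {g : Plane → ℝ}
    (hg : IsPlaneTest Ω g) {f : ℝ → ℝ} (hf : ContDiff ℝ ∞ f) :
    VanishesOn (lateral Ω) (contL2 hbdd (tensor_contDiff hg.1 hf).continuous) := by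
  rw [vanishesOn_iff hbdd]
  have hs := tensor_contDiff hg.1 hf
  refine ⟨fun i => contL2 hbdd (partialDeriv_contDiff hs i).continuous,
    hasWeakPartial_contL2 hbdd hs, fun ε hε => ⟨tensor g f, hs, ?_, by simpa using hε,
      fun i => by simpa using hε⟩⟩
  rw [closure_lateral, disjoint_left]
  intro x hx hx'
  have h1 := hg.2.2 (tsupport_tensor_subset g f hx).1
  have h2 := hx'.1
  rw [Ω.isOpen.frontier_eq] at h2
  exact h2.2 h1

lemma vanishesOn_faces_tensor (hbdd : Bornology.IsBounded (Ω : Set Plane)) {g : Plane → ℝ}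
    (hg : IsPlaneTest Ω g) {s : ℝ → ℝ} (hs : ContDiff ℝ ∞ s) {M : ℝ}
    (hM : ∀ t ∈ Ioo (0 : ℝ) 1, |s t| ≤ M * (t * (1 - t))) :
    VanishesOn (faces Ω) (contL2 hbdd (tensor_contDiff hg.1 hs).continuous) := by
  rw [vanishesOn_iff hbdd]
  have hts := tensor_contDiff hg.1 hs
  refine ⟨fun i => contL2 hbdd (partialDeriv_contDiff hts i).continuous,
    hasWeakPartial_contL2 hbdd hts, fun ε hε => ?_⟩
  obtain ⟨D, hD, ht⟩ := exists_vcut_mul_bounds hs hM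
  have hsm : ∀ n, ContDiff ℝ ∞ (fun t => s t * vcut n t) := fun n => hs.mul (vcut_contDiff n)
  have bound : ∀ {h : Plane → ℝ}, IsPlaneTest Ω h → ∃ B, 0 ≤ B ∧ ∀ x, |h x| ≤ B := by
    intro h hh
    obtain ⟨B, hB⟩ := hh.2.1.exists_bound_of_continuous hh.1.continuous
    exact ⟨B, (norm_nonneg _).trans (hB 0), hB⟩
  have hΦ : ∀ n, ContDiff ℝ ∞ (tensor g (fun t => s t * vcut n t)) := fun n =>
    tensor_contDiff hg.1 (hsm n)
  have h0 : ∀ᶠ n in atTop, ‖contL2 hbdd hts.continuous - contL2 hbdd (hΦ n).continuous‖ < ε := by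
    obtain ⟨B, hB0, hB⟩ := bound hg
    refine (tendsto_contL2 hbdd (fun n => (hΦ n).continuous) hts.continuous (C := B * D)
      (fun n x hx => ?_) (fun x hx => ?_)).eventually_lt_const hε
    · rw [tensor, abs_mul]
      exact mul_le_mul (hB _) (hD n _ hx.2).1 (abs_nonneg _) hB0
    · filter_upwards [ht _ hx.2] with n hn
      simp only [tensor, hn.1]
  have h1 : ∀ i, ∀ᶠ n in atTop, ‖contL2 hbdd (partialDeriv_contDiff hts i).continuous -
      contL2 hbdd (partialDeriv_contDiff (hΦ n) i).continuous‖ < ε := by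
    intro i
    refine Fin.lastCases ?_ (fun j => ?_) i
    · obtain ⟨B, hB0, hB⟩ := bound hg
      refine (tendsto_contL2 hbdd (fun n => (partialDeriv_contDiff (hΦ n) 2).continuous)
        (partialDeriv_contDiff hts 2).continuous (C := B * D)
        (fun n x hx => ?_) (fun x hx => ?_)).eventually_lt_const hε
      · rw [partialDeriv_tensor_two hg.1 (hsm n), tensor, abs_mul]
        exact mul_le_mul (hB _) (hD n _ hx.2).2 (abs_nonneg _) hB0
      · filter_upwards [ht _ hx.2] with n hn
        rw [partialDeriv_tensor_two hg.1 (hsm n), partialDeriv_tensor_two hg.1 hs]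
        simp only [tensor, hn.2]
    · obtain ⟨B, hB0, hB⟩ := bound (hg.planeDeriv j)
      refine (tendsto_contL2 hbdd (fun n => (partialDeriv_contDiff (hΦ n) j.castSucc).continuous)
        (partialDeriv_contDiff hts j.castSucc).continuous (C := B * D)
        (fun n x hx => ?_) (fun x hx => ?_)).eventually_lt_const hε
      · rw [partialDeriv_tensor_castSucc hg.1 (hsm n), tensor, abs_mul]
        exact mul_le_mul (hB _) (hD n _ hx.2).1 (abs_nonneg _) hB0
      · filter_upwards [ht _ hx.2] with n hn
        rw [partialDeriv_tensor_castSucc hg.1 (hsm n), partialDeriv_tensor_castSucc hg.1 hs]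
        simp only [tensor, hn.1]
  obtain ⟨n, hn0, hn1⟩ := (h0.and (eventually_all.2 h1)).exists
  refine ⟨_, hΦ n, ?_, hn0, hn1⟩
  rw [closure_faces, disjoint_left]
  intro x hx hx'
  have h2 : x.2 ∈ Ioo (0 : ℝ) 1 := tsupport_vcut_subset n
    (tsupport_mul_subset_right (f := s) (tsupport_tensor_subset _ _ hx).2)
  rcases hx'.2 with h | h
  · exact h2.1.ne' h
  · exact h2.2.ne h

/-- The components of the field `(a₁ ⊗ c, a₂ ⊗ c, b ⊗ s)`. -/
def productField (a : Fin 2 → Plane → ℝ) (b : Plane → ℝ) (c s : ℝ → ℝ) : Fin 3 → Space → ℝ :=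
  Fin.lastCases (tensor b s) (fun j => tensor (a j) c)

lemma productField_castSucc (a : Fin 2 → Plane → ℝ) (b : Plane → ℝ) (c s : ℝ → ℝ) (j : Fin 2) :
    productField a b c s j.castSucc = tensor (a j) c := by
  simp [productField]

lemma productField_two (a : Fin 2 → Plane → ℝ) (b : Plane → ℝ) (c s : ℝ → ℝ) :
    productField a b c s 2 = tensor b s :=
  Fin.lastCases_last (motive := fun _ => Space → ℝ)

lemma productField_contDiff {a : Fin 2 → Plane → ℝ} {b : Plane → ℝ} {c s : ℝ → ℝ}
    (ha : ∀ j, ContDiff ℝ ∞ (a j)) (hb : ContDiff ℝ ∞ b) (hc : ContDiff ℝ ∞ c)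
    (hs : ContDiff ℝ ∞ s) (i : Fin 3) : ContDiff ℝ ∞ (productField a b c s i) := by
  refine Fin.lastCases ?_ (fun j => ?_) i
  · exact (productField_two a b c s).symm ▸ tensor_contDiff hb hs
  · rw [productField_castSucc]
    exact tensor_contDiff (ha j) hc

/-- The class of a continuous field in `L²(Q)³`. -/
def contField (hbdd : Bornology.IsBounded (Ω : Set Plane)) {φ : Fin 3 → Space → ℝ}
    (hφ : ∀ i, Continuous (φ i)) : L2Field (cylinder Ω) :=
  WithLp.toLp 2 fun i => contL2 hbdd (hφ i)

/-- Divergence-free product fields with compact horizontal support whose vertical component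
vanishes at the faces belong to `H̃¹₀(Q)`. -/
lemma productField_mem (hbdd : Bornology.IsBounded (Ω : Set Plane)) {a : Fin 2 → Plane → ℝ}
    {b : Plane → ℝ} {c s : ℝ → ℝ} (ha : ∀ j, IsPlaneTest Ω (a j)) (hb : IsPlaneTest Ω b)
    (hc : ContDiff ℝ ∞ c) (hs : ContDiff ℝ ∞ s) {M : ℝ}
    (hM : ∀ t ∈ Ioo (0 : ℝ) 1, |s t| ≤ M * (t * (1 - t)))
    (hdiv : ∀ x t, (∑ j, planeDeriv j (a j) x) * c t + b x * deriv s t = 0) :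
    contField hbdd (fun i => (productField_contDiff (fun j => (ha j).1) hb.1 hc hs i).continuous) ∈
      HTilde10 Ω := by
  set φ := productField a b c s with hφdef
  have hφ : ∀ i, ContDiff ℝ ∞ (φ i) := productField_contDiff (fun j => (ha j).1) hb.1 hc hs
  have hwp := fun i j => hasWeakPartial_contL2 hbdd (hφ i) j
  refine ⟨fun i j => ⟨_, hwp i j⟩, fun ψ hψ => ?_, fun i => ?_, ?_⟩
  · have e : ∀ i, ∫ x in cylinder Ω, contL2 hbdd (hφ i).continuous x * partialDeriv i ψ x =
        -∫ x in cylinder Ω, partialDeriv i (φ i) x * ψ x := fun i => by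
      rw [hwp i i ψ hψ, integral_contL2_mul]
    have hint : ∀ i, Integrable (fun x => partialDeriv i (φ i) x * ψ x)
        (volume.restrict (cylinder Ω)) := fun i =>
      (memLp_of_continuous hbdd (partialDeriv_contDiff (hφ i) i).continuous).integrable_mul
        hψ.memLp
    refine (Finset.sum_congr rfl fun i _ => e i).trans ?_
    rw [Finset.sum_neg_distrib, ← integral_finsetSum _ fun i _ => hint i, neg_eq_zero]
    refine integral_eq_zero_of_ae (ae_of_all _ fun x => ?_)
    have h2 : partialDeriv 2 (φ 2) x = b x.1 * deriv s x.2 := by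
      rw [hφdef, productField_two, partialDeriv_tensor_two hb.1 hs, tensor]
    have h3 : ∀ j : Fin 2, partialDeriv j.castSucc (φ j.castSucc) x =
        planeDeriv j (a j) x.1 * c x.2 := fun j => by
      rw [hφdef, productField_castSucc, partialDeriv_tensor_castSucc (ha j).1 hc, tensor]
    change ∑ i, partialDeriv i (φ i) x * ψ x = 0
    rw [← Finset.sum_mul, Fin.sum_univ_castSucc]
    simp only [h3]
    rw [show Fin.last 2 = 2 from rfl, h2, ← Finset.sum_mul, hdiv]
    simp
  · refine Fin.lastCases ?_ (fun j => ?_) i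
    · have := vanishesOn_lateral_tensor hbdd hb hs
      change VanishesOn _ (contL2 hbdd (hφ 2).continuous)
      convert this using 2
      exact productField_two a b c s
    · have := vanishesOn_lateral_tensor hbdd (ha j) hc
      change VanishesOn _ (contL2 hbdd (hφ j.castSucc).continuous)
      convert this using 2
      exact productField_castSucc a b c s j
  · have := vanishesOn_faces_tensor hbdd hb hs hM
    change VanishesOn _ (contL2 hbdd (hφ 2).continuous)
    convert this using 2
    exact productField_two a b c s

/-! ### Reduction to the orthogonal complement -/

/-- The pair `(w, z)`, thought of as `(w, ∂₃ w)`, is orthogonal to `H̃¹₀(Q)` for the inner product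
of `H̃^{0,1}(Q)`. -/
def IsOrthogonal (w z : L2Field (cylinder Ω)) : Prop :=
  ∀ v v' : L2Field (cylinder Ω), v ∈ HTilde10 Ω → (∀ i, HasWeakPartial 2 (v i) (v' i)) →
    ∑ i, inner ℝ (w i) (v i) + ∑ i, inner ℝ (z i) (v' i) = 0

lemma HTilde01.vert_eq (u : HTilde01 Ω) {w : L2Field (cylinder Ω)}
    (hw : ∀ i, HasWeakPartial 2 (HTilde01.toL2 u i) (w i)) : HTilde01.vert u = w := by
  ext1 i
  exact (HTilde01.hasWeakPartial_vert u i).unique (isOpen_cylinder Ω) (hw i)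

/-- `H̃^{0,1}(Q)` is complete: all the conditions defining it are closed. -/
lemma HTilde01.isClosed_range_graph (hbdd : Bornology.IsBounded (Ω : Set Plane)) :
    IsClosed (LinearMap.range (HTilde01.graph (Ω := Ω)) :
      Set (WithLp 2 (L2Field (cylinder Ω) × L2Field (cylinder Ω)))) := by
  have e : (LinearMap.range (HTilde01.graph (Ω := Ω)) :
      Set (WithLp 2 (L2Field (cylinder Ω) × L2Field (cylinder Ω)))) =
      {p | (∀ (φ : Space → ℝ) (hφ : IsTest (cylinder Ω) φ), ∑ i, inner ℝ (p.fst i)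
          (contL2 hbdd (partialDeriv_contDiff hφ.1 i).continuous) = 0) ∧
        (∀ (ψ : L2 (cylinder Ω)) (g : Fin 3 → L2 (cylinder Ω)),
          (∀ i, HasWeakPartial i ψ (g i)) → ∑ i, inner ℝ (p.fst i) (g i) = 0) ∧
        ∀ (i : Fin 3) (φ : Space → ℝ) (hφ : IsTest (cylinder Ω) φ),
          inner ℝ (p.fst i) (contL2 hbdd (partialDeriv_contDiff hφ.1 2).continuous) =
            -inner ℝ (p.snd i) (contL2 hbdd hφ.1.continuous)} := by
    ext p
    simp only [← integral_mul_eq_inner, integral_mul_contL2]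
    constructor
    · rintro ⟨u, rfl⟩
      exact ⟨u.2.1, u.2.2.1, HTilde01.hasWeakPartial_vert u⟩
    · rintro ⟨h1, h2, h3⟩
      let u : HTilde01 Ω := ⟨p.fst, h1, h2, p.snd, h3⟩
      refine ⟨u, ?_⟩
      have hv : HTilde01.vert u = p.snd := HTilde01.vert_eq u h3
      change WithLp.toLp 2 (p.fst, HTilde01.vert u) = p
      rw [hv]
      rfl
  have c1 : ∀ i, Continuous
      fun p : WithLp 2 (L2Field (cylinder Ω) × L2Field (cylinder Ω)) => p.fst i := by
    intro i; fun_prop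
  have c2 : ∀ i, Continuous
      fun p : WithLp 2 (L2Field (cylinder Ω) × L2Field (cylinder Ω)) => p.snd i := by
    intro i; fun_prop
  rw [e]
  simp only [ofPred_and, ofPred_forall]
  refine IsClosed.inter ?_ (IsClosed.inter ?_ ?_)
  · exact isClosed_iInter fun φ => isClosed_iInter fun hφ =>
      isClosed_eq (continuous_finsetSum _ fun i _ => (c1 i).inner continuous_const)
        continuous_const
  · exact isClosed_iInter fun ψ => isClosed_iInter fun g => isClosed_iInter fun _ =>
      isClosed_eq (continuous_finsetSum _ fun i _ => (c1 i).inner continuous_const)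
        continuous_const
  · exact isClosed_iInter fun i => isClosed_iInter fun φ => isClosed_iInter fun hφ =>
      isClosed_eq ((c1 i).inner continuous_const) ((c2 i).inner continuous_const).neg

lemma HTilde01.dense_of_orthogonal (hbdd : Bornology.IsBounded (Ω : Set Plane))
    (H : ∀ w z : L2Field (cylinder Ω), IsDivFree w → NormalTraceEqZero w →
      (∀ i, HasWeakPartial 2 (w i) (z i)) → IsOrthogonal w z → w = 0) :
    Dense {u : HTilde01 Ω | HTilde01.toL2 u ∈ HTilde10 Ω} := by
  have hiso : Isometry (HTilde01.graph (Ω := Ω)) :=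
    AddMonoidHomClass.isometry_of_norm _ fun _ => rfl
  intro u
  rw [hiso.isEmbedding.isInducing.closure_eq_preimage_closure_image]
  set K := ((hTilde10 hbdd).map (HTilde01.graph (Ω := Ω))).topologicalClosure with hK
  have hKc : CompleteSpace K :=
    (Submodule.isClosed_topologicalClosure _).completeSpace_coe
  have hKr : K ≤ LinearMap.range (HTilde01.graph (Ω := Ω)) :=
    Submodule.topologicalClosure_minimal _ LinearMap.map_le_range
      (HTilde01.isClosed_range_graph hbdd)
  obtain ⟨y, hy, z, hz, hyz⟩ := K.exists_add_mem_mem_orthogonal (HTilde01.graph u)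
  obtain ⟨y', rfl⟩ := hKr hy
  obtain rfl : z = HTilde01.graph (u - y') := by
    rw [map_sub, hyz, add_sub_cancel_left]
  have h0 : HTilde01.toL2 (u - y') = 0 := by
    refine H _ (HTilde01.vert (u - y')) (u - y').2.1 (u - y').2.2.1
      (HTilde01.hasWeakPartial_vert (u - y')) fun v v' hv hv' => ?_
    let V : HTilde01 Ω := ⟨v, HTilde10.mem_hTilde01 hbdd hv⟩
    have hvert : HTilde01.vert V = v' := HTilde01.vert_eq V hv'
    have hVK : HTilde01.graph V ∈ K :=
      Submodule.le_topologicalClosure _ (Submodule.mem_map_of_mem hv)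
    have h := hz _ hVK
    rw [real_inner_comm, WithLp.prod_inner_apply, PiLp.inner_apply, PiLp.inner_apply] at h
    rw [← hvert]
    exact h
  have h1 : u = y' := by
    have : u - y' = 0 := Subtype.ext h0
    exact sub_eq_zero.1 this
  subst h1
  have := hy
  rw [hK, ← SetLike.mem_coe, Submodule.topologicalClosure_coe, Submodule.map_coe] at this
  exact this

/-! ### Orthogonality to product fields -/

lemma IsOrthogonal.productField (hbdd : Bornology.IsBounded (Ω : Set Plane))
    {w z : L2Field (cylinder Ω)} (h : IsOrthogonal w z) {a : Fin 2 → Plane → ℝ}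
    {b : Plane → ℝ} {c s : ℝ → ℝ} (ha : ∀ j, IsPlaneTest Ω (a j)) (hb : IsPlaneTest Ω b)
    (hc : ContDiff ℝ ∞ c) (hs : ContDiff ℝ ∞ s) {M : ℝ}
    (hM : ∀ t ∈ Ioo (0 : ℝ) 1, |s t| ≤ M * (t * (1 - t)))
    (hdiv : ∀ x t, (∑ j, planeDeriv j (a j) x) * c t + b x * deriv s t = 0) :
    ∑ j : Fin 2, ((∫ x in cylinder Ω, w j.castSucc x * tensor (a j) c x) +
        ∫ x in cylinder Ω, z j.castSucc x * tensor (a j) (deriv c) x) +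
      ((∫ x in cylinder Ω, w 2 x * tensor b s x) +
        ∫ x in cylinder Ω, z 2 x * tensor b (deriv s) x) = 0 := by
  have hφ := productField_contDiff (fun j => (ha j).1) hb.1 hc hs
  have key := h _ (contField hbdd fun i => (partialDeriv_contDiff (hφ i) 2).continuous)
    (productField_mem hbdd ha hb hc hs hM hdiv) (fun i => hasWeakPartial_contL2 hbdd (hφ i) 2)
  rw [← Finset.sum_add_distrib] at key
  have e : ∀ i, inner ℝ (w i) (contField hbdd (fun i => (hφ i).continuous) i) +
      inner ℝ (z i) (contField hbdd
        (fun i => (partialDeriv_contDiff (hφ i) 2).continuous) i) =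
      (∫ x in cylinder Ω, w i x * AnisotropicNS.productField a b c s i x) +
        ∫ x in cylinder Ω, z i x *
          partialDeriv 2 (AnisotropicNS.productField a b c s i) x := fun i => by
    rw [← integral_mul_eq_inner, ← integral_mul_eq_inner]
    exact congrArg₂ (· + ·) (integral_mul_contL2 hbdd (hφ i).continuous _)
      (integral_mul_contL2 hbdd (partialDeriv_contDiff (hφ i) 2).continuous _)
  simp only [e] at key
  rw [Fin.sum_univ_castSucc] at key
  simp only [productField_castSucc] at key
  rw [show Fin.last 2 = 2 from rfl, productField_two, partialDeriv_tensor_two hb.1 hs] at key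
  simpa only [partialDeriv_tensor_two (ha _).1 hc] using key

lemma integral_tensor_const_mul {f : L2 (cylinder Ω)} (g : Plane → ℝ) (s : ℝ → ℝ) (κ : ℝ)
    {s' : ℝ → ℝ} (hs' : ∀ t, s' t = κ * s t) :
    ∫ x in cylinder Ω, f x * tensor g s' x = κ * ∫ x in cylinder Ω, f x * tensor g s x := by
  rw [← integral_const_mul]
  congr 1
  ext x
  rw [tensor, tensor, hs']
  ring

/-- The weak form of `w₃ = 0` on the faces: vertical integration by parts has no boundary terms,
for arbitrary vertical profiles `c`. -/
lemma integral_vert_tensor (hbdd : Bornology.IsBounded (Ω : Set Plane))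
    {w : L2Field (cylinder Ω)} (hdiv : IsDivFree w) (hn : NormalTraceEqZero w)
    {z : L2 (cylinder Ω)} (hz : HasWeakPartial 2 (w 2) z) {g : Plane → ℝ}
    (hg : IsPlaneTest Ω g) {c : ℝ → ℝ} (hc : ContDiff ℝ ∞ c) :
    ∫ x in cylinder Ω, z x * tensor g c x =
      -∫ x in cylinder Ω, w 2 x * tensor g (deriv c) x := by
  have hgc := tensor_contDiff hg.1 hc
  -- the normal trace, tested with `g ⊗ c`
  have h1 := hn _ _ (hasWeakPartial_contL2 hbdd hgc)
  simp only [integral_mul_contL2] at h1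
  rw [Fin.sum_univ_castSucc, show Fin.last 2 = 2 from rfl,
    partialDeriv_tensor_two hg.1 hc] at h1
  simp only [partialDeriv_tensor_castSucc hg.1 hc] at h1
  -- the divergence, tested with `g ⊗ (c ηₙ)`
  have hsm : ∀ n, ContDiff ℝ ∞ (fun t => c t * vcut n t) := fun n => hc.mul (vcut_contDiff n)
  have h2 : ∀ n, ∑ j : Fin 2, ∫ x in cylinder Ω, w j.castSucc x *
      tensor (planeDeriv j g) (fun t => c t * vcut n t) x =
        ∫ x in cylinder Ω, z x * tensor g (fun t => c t * vcut n t) x := by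
    intro n
    have ht : IsTest (cylinder Ω) (tensor g (fun t => c t * vcut n t)) :=
      isTest_tensor hg (hsm n) (hasCompactSupport_vcut n).mul_left
        ((tsupport_mul_subset_right (f := c)).trans (tsupport_vcut_subset n))
    have h := hdiv _ ht
    rw [Fin.sum_univ_castSucc, show Fin.last 2 = 2 from rfl, hz _ ht] at h
    simp only [partialDeriv_tensor_castSucc hg.1 (hsm n)] at h
    linarith
  have hlim : ∀ (f : L2 (cylinder Ω)) {h : Plane → ℝ}, IsPlaneTest Ω h →
      Tendsto (fun n => ∫ x in cylinder Ω, f x * tensor h (fun t => c t * vcut n t) x) atTop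
        (𝓝 (∫ x in cylinder Ω, f x * tensor h c x)) := by
    intro f h hh
    obtain ⟨C, hC⟩ := exists_bound_cylinder hbdd (tensor_contDiff hh.1 hc).continuous
    refine tendsto_integral_mul hbdd f (fun n => (tensor_contDiff hh.1 (hsm n)).continuous)
      (C := C) (fun n x hx => ?_) (fun x hx => ?_)
    · refine le_trans ?_ (hC x hx)
      rw [tensor, tensor, ← mul_assoc, abs_mul, abs_of_nonneg (vcut_mem n _).1]
      exact mul_le_of_le_one_right (abs_nonneg _) (vcut_mem n _).2
    · refine tendsto_const_nhds.congr' ?_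
      filter_upwards [vcut_eventually_eq_one hx.2] with n hn
      rw [tensor, tensor, hn.eq_of_nhds, mul_one]
  have h3 := tendsto_nhds_unique
    ((tendsto_finsetSum Finset.univ fun j _ => hlim (w j.castSucc) (hg.planeDeriv j)).congr h2)
    (hlim z hg)
  linarith

lemma abs_sin_le_mul (k : ℕ) : ∀ t ∈ Ioo (0 : ℝ) 1,
    |Real.sin (k * Real.pi * t)| ≤ 2 * (k * Real.pi) * (t * (1 - t)) := by
  intro t ht
  have hκ : 0 ≤ k * Real.pi := by positivity
  have h1 : |Real.sin (k * Real.pi * t)| ≤ k * Real.pi * t := by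
    refine (Real.abs_sin_le_abs).trans ?_
    rw [abs_of_nonneg (mul_nonneg hκ ht.1.le)]
  have h2 : |Real.sin (k * Real.pi * t)| ≤ k * Real.pi * (1 - t) := by
    have h : |Real.sin (k * Real.pi * t)| = |Real.sin (k * Real.pi * (1 - t))| := by
      rw [mul_sub, mul_one, Real.sin_nat_mul_pi_sub]
      simp
    rw [h]
    refine (Real.abs_sin_le_abs).trans ?_
    rw [abs_of_nonneg (mul_nonneg hκ (by linarith [ht.2]))]
  -- a convex combination of the two bounds
  nlinarith [mul_le_mul_of_nonneg_left h1 (by linarith [ht.2] : (0 : ℝ) ≤ 1 - t),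
    mul_le_mul_of_nonneg_left h2 ht.1.le]

/-- Orthogonality to the fields `(a cos(κx₃), -κ⁻¹ div a sin(κx₃))`, `κ = kπ`, says that
the `k`-th vertical Fourier coefficients of `w_h` and `w₃` satisfy `-κ (w_h)_k = ∇(w₃)_k`. -/
lemma IsOrthogonal.fourier (hbdd : Bornology.IsBounded (Ω : Set Plane))
    {w z : L2Field (cylinder Ω)} (hdiv : IsDivFree w) (hn : NormalTraceEqZero w)
    (hz : ∀ i, HasWeakPartial 2 (w i) (z i)) (h : IsOrthogonal w z) {k : ℕ} (hk : k ≠ 0)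
    (j : Fin 2) {g : Plane → ℝ} (hg : IsPlaneTest Ω g) :
    (k * Real.pi) * ∫ x in cylinder Ω,
        w j.castSucc x * tensor g (fun t => Real.cos (k * Real.pi * t)) x =
      ∫ x in cylinder Ω,
        w 2 x * tensor (planeDeriv j g) (fun t => Real.sin (k * Real.pi * t)) x := by
  set κ : ℝ := k * Real.pi with hκdef
  have hκ : 0 < κ := by positivity
  set c : ℝ → ℝ := fun t => Real.cos (κ * t) with hcdef
  set s : ℝ → ℝ := fun t => Real.sin (κ * t) with hsdef
  have hc : ContDiff ℝ ∞ c := Real.contDiff_cos.comp (by fun_prop)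
  have hs : ContDiff ℝ ∞ s := Real.contDiff_sin.comp (by fun_prop)
  have hs' : ∀ t, deriv s t = κ * c t := fun t => by
    have : HasDerivAt s (Real.cos (κ * t) * (κ * 1)) t :=
      ((hasDerivAt_id t).const_mul κ).sin
    rw [this.deriv, hcdef]; ring
  have hc' : ∀ t, deriv c t = (-κ) * s t := fun t => by
    have : HasDerivAt c (-Real.sin (κ * t) * (κ * 1)) t :=
      ((hasDerivAt_id t).const_mul κ).cos
    rw [this.deriv, hsdef]; ring
  have hM := abs_sin_le_mul k
  have hb : IsPlaneTest Ω (fun x => -κ⁻¹ * planeDeriv j g x) :=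
    ⟨contDiff_const.mul (hg.planeDeriv j).1, (hg.planeDeriv j).2.1.mul_left,
      (tsupport_mul_subset_right (f := fun _ => -κ⁻¹)).trans (hg.planeDeriv j).2.2⟩
  have h0 : IsPlaneTest Ω (0 : Plane → ℝ) :=
    ⟨contDiff_const, HasCompactSupport.zero, by simp [tsupport]⟩
  have ha : ∀ i, IsPlaneTest Ω ((Pi.single j g : Fin 2 → Plane → ℝ) i) := fun i => by
    by_cases hij : i = j
    · subst hij; simpa using hg
    · simpa [hij] using h0
  have hsum : ∀ x, ∑ i, planeDeriv i ((Pi.single j g : Fin 2 → Plane → ℝ) i) x =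
      planeDeriv j g x := fun x => by
    rw [Finset.sum_eq_single j]
    · simp
    · intro i _ hij
      simp [hij, planeDeriv]
    · simp
  have key := h.productField hbdd ha hb hc hs hM (fun x t => by
    rw [hsum, hs']; field_simp; ring)
  rw [Finset.sum_eq_single j (by intro i _ hij; simp [hij, tensor]) (by simp)] at key
  simp only [Pi.single_eq_same] at key
  have e1 : ∫ x in cylinder Ω, z j.castSucc x * tensor g (deriv c) x =
      κ ^ 2 * ∫ x in cylinder Ω, w j.castSucc x * tensor g c x := by
    have e := (hz j.castSucc).integral_tensor hbdd hg hs hM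
    rw [integral_tensor_const_mul g c κ hs'] at e
    rw [integral_tensor_const_mul g s (-κ) hc']
    linear_combination -κ * e
  have e2 : ∫ x in cylinder Ω, z 2 x * tensor (fun x => -κ⁻¹ * planeDeriv j g x) (deriv s) x =
      κ ^ 2 * ∫ x in cylinder Ω, w 2 x * tensor (fun x => -κ⁻¹ * planeDeriv j g x) s x := by
    have e := integral_vert_tensor hbdd hdiv hn (hz 2) hb hc
    rw [integral_tensor_const_mul _ s (-κ) hc'] at e
    rw [integral_tensor_const_mul _ c κ hs', e]
    ring
  have e3 : ∫ x in cylinder Ω, w 2 x * tensor (fun x => -κ⁻¹ * planeDeriv j g x) s x =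
      -κ⁻¹ * ∫ x in cylinder Ω, w 2 x * tensor (planeDeriv j g) s x := by
    rw [← integral_const_mul]
    congr 1
    ext x
    rw [tensor, tensor]
    ring
  rw [e1, e2, e3] at key
  have hfac : (1 + κ ^ 2) * ((∫ x in cylinder Ω, w j.castSucc x * tensor g c x) -
      κ⁻¹ * ∫ x in cylinder Ω, w 2 x * tensor (planeDeriv j g) s x) = 0 := by
    linear_combination key
  have h4 := (mul_eq_zero.1 hfac).resolve_left (by positivity)
  rw [sub_eq_zero.1 h4, mul_inv_cancel_left₀ hκ.ne']

/-! ### Vertical moments and product functions in `H¹(Q)` -/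

lemma sq_integral_le_mul_integral_sq {β : Type*} [MeasurableSpace β] {ν : Measure β}
    [IsFiniteMeasure ν] {g : β → ℝ} (hg : MemLp g 2 ν) :
    (∫ y, g y ∂ν) ^ 2 ≤ ν.real univ * ∫ y, g y ^ 2 ∂ν := by
  have h1 := hg.integrable (by norm_num : (1 : ℝ≥0∞) ≤ 2)
  have h2 := hg.integrable_sq
  set V := ν.real univ with hV
  set m := ∫ y, g y ∂ν with hm
  -- expand `0 ≤ ∫ (V g - m)²`
  have h3 : ∫ y, (V * g y - m) ^ 2 ∂ν = V * (V * ∫ y, g y ^ 2 ∂ν - m ^ 2) := by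
    have e : ∀ y, (V * g y - m) ^ 2 = (V ^ 2 * g y ^ 2 - 2 * V * m * g y) + m ^ 2 := fun y => by
      ring
    simp only [e]
    have hi : Integrable (fun y => V ^ 2 * g y ^ 2 - 2 * V * m * g y) ν :=
      (h2.const_mul _).sub (h1.const_mul _)
    rw [integral_add hi (integrable_const _), integral_sub (h2.const_mul _) (h1.const_mul _), integral_const_mul, integral_const_mul,
      integral_const, smul_eq_mul, ← hV, ← hm]
    ring
  have h4 : 0 ≤ ∫ y, (V * g y - m) ^ 2 ∂ν := integral_nonneg fun y => sq_nonneg _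
  rcases (measureReal_nonneg : 0 ≤ ν.real univ).eq_or_lt with h0 | h0
  · have : ν = 0 := by
      rw [← Measure.measure_univ_eq_zero]
      exact (measureReal_eq_zero_iff).1 h0.symm
    simp [hm, hV, this]
  · rw [h3] at h4
    linarith [(mul_nonneg_iff_of_pos_left h0).1 h4]

/-- Integrating out one variable over a finite measure space maps `L²` into `L²`. -/
lemma memLp_two_integral_prod {α β : Type*} [MeasurableSpace α] [MeasurableSpace β]
    {μ : Measure α} {ν : Measure β} [SFinite μ] [IsFiniteMeasure ν] {F : α × β → ℝ}
    (hF : MemLp F 2 (μ.prod ν)) : MemLp (fun x => ∫ y, F (x, y) ∂ν) 2 μ := by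
  have hm : AEStronglyMeasurable (fun x => ∫ y, F (x, y) ∂ν) μ := hF.1.integral_prod_right'
  rw [memLp_two_iff_integrable_sq hm]
  refine Integrable.mono' ((hF.integrable_sq.integral_prod_left).const_mul (ν.real univ))
    (hm.pow 2) ?_
  filter_upwards [hF.integrable_sq.prod_right_ae, hF.1.prodMk_left] with x h1 h2
  rw [norm_pow, Real.norm_eq_abs, sq_abs]
  exact sq_integral_le_mul_integral_sq ((memLp_two_iff_integrable_sq h2).2 h1)

lemma restrict_cylinder : (volume : Measure Space).restrict (cylinder Ω) =
    (volume.restrict (Ω : Set Plane)).prod (volume.restrict (Ioo (0 : ℝ) 1)) :=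
  (Measure.prod_restrict _ _).symm

lemma memLp_vert_of_continuous {c : ℝ → ℝ} (hc : Continuous c) :
    MemLp c 2 (volume.restrict (Ioo (0 : ℝ) 1)) := by
  obtain ⟨C, hC⟩ := isCompact_Icc.exists_bound_of_continuousOn (s := Icc (0 : ℝ) 1) hc.continuousOn
  exact MemLp.of_bound hc.aestronglyMeasurable C ((ae_restrict_iff' measurableSet_Ioo).2
    (ae_of_all _ fun t ht => hC t (Ioo_subset_Icc_self ht)))

lemma memLp_tensor {h : Plane → ℝ} (hh : MemLp h 2 (volume.restrict (Ω : Set Plane))) {c : ℝ → ℝ}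
    (hc : Continuous c) : MemLp (tensor h c) 2 (volume.restrict (cylinder Ω)) := by
  rw [restrict_cylinder]
  have hm : AEStronglyMeasurable (tensor h c)
      ((volume.restrict (Ω : Set Plane)).prod (volume.restrict (Ioo (0 : ℝ) 1))) :=
    hh.1.comp_fst.mul hc.aestronglyMeasurable.comp_snd
  rw [memLp_two_iff_integrable_sq hm]
  have := hh.integrable_sq.mul_prod (memLp_vert_of_continuous hc).integrable_sq
  simpa only [tensor, mul_pow] using this

/-- The vertical moment `∫₀¹ f(x_h, t) c(t) dt`. -/
def vertCoeff (f : Space → ℝ) (c : ℝ → ℝ) (x : Plane) : ℝ := ∫ t in Ioo (0 : ℝ) 1, f (x, t) * c t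

lemma memLp_vertCoeff (f : L2 (cylinder Ω)) {c : ℝ → ℝ} (hc : Continuous c) :
    MemLp (vertCoeff f c) 2 (volume.restrict (Ω : Set Plane)) := by
  refine memLp_two_integral_prod (F := fun x : Space => f x * c x.2) ?_
  rw [← restrict_cylinder]
  obtain ⟨C, hC⟩ := isCompact_Icc.exists_bound_of_continuousOn (s := Icc (0 : ℝ) 1) hc.continuousOn
  refine MemLp.of_le_mul (c := C) (Lp.memLp f)
    ((Lp.memLp f).1.mul (hc.comp continuous_snd).aestronglyMeasurable) ?_
  refine (ae_restrict_iff' (isOpen_cylinder Ω).measurableSet).2 (ae_of_all _ fun x hx => ?_)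
  rw [norm_mul, mul_comm]
  exact mul_le_mul_of_nonneg_right (hC _ (Ioo_subset_Icc_self hx.2)) (norm_nonneg _)

lemma integral_mul_tensor (f : L2 (cylinder Ω)) {h : Plane → ℝ}
    (hh : MemLp h 2 (volume.restrict (Ω : Set Plane))) {c : ℝ → ℝ} (hc : Continuous c) :
    ∫ x in cylinder Ω, f x * tensor h c x = ∫ x in (Ω : Set Plane), vertCoeff f c x * h x := by
  have hint : Integrable (fun x => f x * tensor h c x)
      ((volume.restrict (Ω : Set Plane)).prod (volume.restrict (Ioo (0 : ℝ) 1))) := by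
    rw [← restrict_cylinder]
    exact (Lp.memLp f).integrable_mul (memLp_tensor hh hc)
  have e := integral_prod _ hint
  rw [← restrict_cylinder] at e
  rw [e]
  congr 1
  ext x
  rw [vertCoeff, ← integral_mul_const]
  congr 1
  ext t
  simp only [tensor]
  ring

lemma IsPlaneTest.memLp {Ω : Set Plane} {g : Plane → ℝ} (h : IsPlaneTest Ω g) (S : Set Plane) :
    MemLp g 2 (volume.restrict S) :=
  (h.1.continuous.memLp_of_hasCompactSupport h.2.1).restrict S

/-- `g = ∂ⱼ f` in the sense of distributions on the plane open set `Ω`. -/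
def HasPlaneWeakPartial (Ω : Set Plane) (j : Fin 2) (f g : Plane → ℝ) : Prop :=
  ∀ φ : Plane → ℝ, IsPlaneTest Ω φ → ∫ x in Ω, f x * planeDeriv j φ x = -∫ x in Ω, g x * φ x

lemma IsTest.slice {φ : Space → ℝ} (hφ : IsTest (cylinder Ω) φ) (t : ℝ) :
    IsPlaneTest Ω (fun x => φ (x, t)) := by
  have hs : tsupport (fun x => φ (x, t)) ⊆ Prod.fst '' tsupport φ :=
    closure_minimal (fun x hx => ⟨(x, t), subset_tsupport φ hx, rfl⟩)
      (hφ.2.1.isCompact.image continuous_fst).isClosed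
  refine ⟨hφ.1.comp (contDiff_id.prodMk contDiff_const),
    (hφ.2.1.isCompact.image continuous_fst).of_isClosed_subset (isClosed_tsupport _) hs, ?_⟩
  intro x hx
  obtain ⟨y, hy, rfl⟩ := hs hx
  exact (hφ.2.2 hy).1

lemma planeDeriv_slice {φ : Space → ℝ} (hφ : ContDiff ℝ ∞ φ) (t : ℝ) (j : Fin 2) (x : Plane) :
    planeDeriv j (fun x => φ (x, t)) x = partialDeriv j.castSucc φ (x, t) := by
  have h1 : HasFDerivAt (fun x : Plane => (x, t)) (ContinuousLinearMap.inl ℝ Plane ℝ) x := by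
    exact (hasFDerivAt_id x).prodMk (hasFDerivAt_const t x)
  have h2 := (hφ.differentiable (by simp) (x, t)).hasFDerivAt.comp x h1
  have h3 : fderiv ℝ (fun x => φ (x, t)) x = _ := h2.fderiv
  rw [planeDeriv, h3, partialDeriv, dir_castSucc]
  simp

lemma hasWeakPartial_tensor_castSucc {j : Fin 2} {f g : Plane → ℝ}
    (hf : MemLp f 2 (volume.restrict (Ω : Set Plane)))
    (hg : MemLp g 2 (volume.restrict (Ω : Set Plane))) (h : HasPlaneWeakPartial Ω j f g)
    {c : ℝ → ℝ} (hc : Continuous c) :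
    HasWeakPartial j.castSucc ((memLp_tensor hf hc).toLp _) ((memLp_tensor hg hc).toLp _) := by
  intro φ hφ
  have e1 : ∫ x in cylinder Ω, (memLp_tensor hf hc).toLp _ x * partialDeriv j.castSucc φ x =
      ∫ x in cylinder Ω, tensor f c x * partialDeriv j.castSucc φ x :=
    integral_congr_ae (by
      filter_upwards [(memLp_tensor hf hc).coeFn_toLp] with x hx; rw [hx])
  have e2 : ∫ x in cylinder Ω, (memLp_tensor hg hc).toLp _ x * φ x =
      ∫ x in cylinder Ω, tensor g c x * φ x :=
    integral_congr_ae (by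
      filter_upwards [(memLp_tensor hg hc).coeFn_toLp] with x hx; rw [hx])
  have i1 : Integrable (fun x => tensor f c x * partialDeriv j.castSucc φ x)
      ((volume.restrict (Ω : Set Plane)).prod (volume.restrict (Ioo (0 : ℝ) 1))) := by
    rw [← restrict_cylinder]
    exact (memLp_tensor hf hc).integrable_mul (hφ.memLp_partialDeriv j.castSucc)
  have i2 : Integrable (fun x => tensor g c x * φ x)
      ((volume.restrict (Ω : Set Plane)).prod (volume.restrict (Ioo (0 : ℝ) 1))) := by
    rw [← restrict_cylinder]
    exact (memLp_tensor hg hc).integrable_mul hφ.memLp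
  rw [e1, e2, restrict_cylinder, integral_prod_symm _ i1, integral_prod_symm _ i2,
    ← integral_neg]
  congr 1
  ext t
  have ht := h _ (hφ.slice t)
  simp only [planeDeriv_slice hφ.1] at ht
  simp only [tensor]
  calc _ = c t * ∫ x in (Ω : Set Plane), f x * partialDeriv j.castSucc φ (x, t) := by
        rw [← integral_const_mul]; congr 1; ext x; ring
    _ = -(c t * ∫ x in (Ω : Set Plane), g x * φ (x, t)) := by rw [ht, mul_neg]
    _ = _ := by rw [← integral_const_mul]; congr 2; ext x; ring

lemma hasWeakPartial_tensor_two {f : Plane → ℝ}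
    (hf : MemLp f 2 (volume.restrict (Ω : Set Plane))) {c : ℝ → ℝ} (hc : ContDiff ℝ ∞ c) :
    HasWeakPartial 2 ((memLp_tensor hf hc.continuous).toLp _)
      ((memLp_tensor hf (hc.continuous_deriv (by simp))).toLp _) := by
  intro φ hφ
  have hc' : Continuous (deriv c) := hc.continuous_deriv (by simp)
  have e1 : ∫ x in cylinder Ω, (memLp_tensor hf hc.continuous).toLp _ x * partialDeriv 2 φ x =
      ∫ x in cylinder Ω, tensor f c x * partialDeriv 2 φ x :=
    integral_congr_ae (by
      filter_upwards [(memLp_tensor hf hc.continuous).coeFn_toLp] with x hx; rw [hx])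
  have e2 : ∫ x in cylinder Ω, (memLp_tensor hf hc').toLp _ x * φ x =
      ∫ x in cylinder Ω, tensor f (deriv c) x * φ x :=
    integral_congr_ae (by
      filter_upwards [(memLp_tensor hf hc').coeFn_toLp] with x hx; rw [hx])
  have i1 : Integrable (fun x => tensor f c x * partialDeriv 2 φ x)
      ((volume.restrict (Ω : Set Plane)).prod (volume.restrict (Ioo (0 : ℝ) 1))) := by
    rw [← restrict_cylinder]
    exact (memLp_tensor hf hc.continuous).integrable_mul (hφ.memLp_partialDeriv 2)
  have i2 : Integrable (fun x => tensor f (deriv c) x * φ x)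
      ((volume.restrict (Ω : Set Plane)).prod (volume.restrict (Ioo (0 : ℝ) 1))) := by
    rw [← restrict_cylinder]
    exact (memLp_tensor hf hc').integrable_mul hφ.memLp
  rw [e1, e2, restrict_cylinder, integral_prod _ i1, integral_prod _ i2, ← integral_neg]
  congr 1
  ext x
  simp only [tensor]
  have hd : ∀ t, HasDerivAt (fun t => φ (x, t)) (partialDeriv 2 φ (x, t)) t := fun t => by
    have h1 : HasDerivAt (fun t : ℝ => (x, t)) ((0 : Plane), (1 : ℝ)) t :=
      (hasDerivAt_const t x).prodMk (hasDerivAt_id t)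
    exact (hφ.1.differentiable (by simp) (x, t)).hasFDerivAt.comp_hasDerivAt t h1
  have hz : ∀ t, t ∉ Ioo (0 : ℝ) 1 → φ (x, t) = 0 := fun t ht =>
    image_eq_zero_of_notMem_tsupport fun h => ht (hφ.2.2 h).2
  have hz' : ∀ t, t ∉ Ioo (0 : ℝ) 1 → partialDeriv 2 φ (x, t) = 0 := fun t ht =>
    image_eq_zero_of_notMem_tsupport fun h =>
      ht (hφ.2.2 (tsupport_fderiv_apply_subset ℝ (dir 2) h)).2
  have k1 : Continuous (fun t => φ (x, t)) := hφ.1.continuous.comp (by fun_prop)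
  have k2 : Continuous (fun t => partialDeriv 2 φ (x, t)) :=
    (partialDeriv_contDiff hφ.1 2).continuous.comp (by fun_prop)
  have hcs : ∀ {h : ℝ → ℝ}, (∀ t, t ∉ Ioo (0 : ℝ) 1 → h t = 0) → HasCompactSupport h :=
    fun {h} h0 => HasCompactSupport.intro (isCompact_Icc (a := (0 : ℝ)) (b := 1)) fun t ht =>
      h0 t fun h' => ht (Ioo_subset_Icc_self h')
  have e := integral_mul_deriv_eq_deriv_mul_of_integrable (u := c) (v := fun t => φ (x, t))
    (u' := deriv c) (v' := fun t => partialDeriv 2 φ (x, t))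
    (fun t _ => (hc.differentiable (by simp)).differentiableAt.hasDerivAt) (fun t _ => hd t)
    ((hc.continuous.mul k2).integrable_of_hasCompactSupport (hcs hz').mul_left)
    ((hc'.mul k1).integrable_of_hasCompactSupport (hcs hz).mul_left)
    ((hc.continuous.mul k1).integrable_of_hasCompactSupport (hcs hz).mul_left)
  have s1 : ∫ t in Ioo (0 : ℝ) 1, c t * partialDeriv 2 φ (x, t) =
      ∫ t, c t * partialDeriv 2 φ (x, t) :=
    setIntegral_eq_integral_of_forall_compl_eq_zero fun t ht => by rw [hz' t ht, mul_zero]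
  have s2 : ∫ t in Ioo (0 : ℝ) 1, deriv c t * φ (x, t) = ∫ t, deriv c t * φ (x, t) :=
    setIntegral_eq_integral_of_forall_compl_eq_zero fun t ht => by rw [hz t ht, mul_zero]
  rw [← s1, ← s2] at e
  simp only [mul_assoc]
  rw [integral_const_mul, integral_const_mul, e, mul_neg]

/-- The vanishing of the normal trace, tested with product functions `f ⊗ c`, `f ∈ H¹(Ω)`. -/
lemma NormalTraceEqZero.tensor {w : L2Field (cylinder Ω)} (hn : NormalTraceEqZero w)
    {f : Plane → ℝ} {g : Fin 2 → Plane → ℝ}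
    (hf : MemLp f 2 (volume.restrict (Ω : Set Plane)))
    (hg : ∀ j, MemLp (g j) 2 (volume.restrict (Ω : Set Plane)))
    (h : ∀ j, HasPlaneWeakPartial Ω j f (g j)) {c : ℝ → ℝ} (hc : ContDiff ℝ ∞ c) :
    (∑ j : Fin 2, ∫ x in (Ω : Set Plane), vertCoeff (w j.castSucc) c x * g j x) +
      ∫ x in (Ω : Set Plane), vertCoeff (w 2) (deriv c) x * f x = 0 := by
  have hc' : Continuous (deriv c) := hc.continuous_deriv (by simp)
  let G : Fin 3 → L2 (cylinder Ω) := Fin.lastCases ((memLp_tensor hf hc').toLp _)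
    (fun j => (memLp_tensor (hg j) hc.continuous).toLp _)
  have hG : ∀ j : Fin 2, G j.castSucc = (memLp_tensor (hg j) hc.continuous).toLp _ := fun j => by
    simp [G]
  have hG2 : G (Fin.last 2) = (memLp_tensor hf hc').toLp _ :=
    Fin.lastCases_last (motive := fun _ => L2 (cylinder Ω))
  have key := hn ((memLp_tensor hf hc.continuous).toLp _) G (fun i => by
    refine Fin.lastCases ?_ (fun j => ?_) i
    · rw [hG2]
      exact hasWeakPartial_tensor_two hf hc
    · rw [hG]
      exact hasWeakPartial_tensor_castSucc hf (hg j) (h j) hc.continuous)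
  have ev : ∀ (v : L2 (cylinder Ω)) {h : Plane → ℝ} {c : ℝ → ℝ}
      (hh : MemLp h 2 (volume.restrict (Ω : Set Plane))) (hc : Continuous c),
      ∫ x in cylinder Ω, v x * (memLp_tensor hh hc).toLp _ x =
        ∫ x in (Ω : Set Plane), vertCoeff v c x * h x := by
    intro v h c hh hc
    rw [← integral_mul_tensor v hh hc]
    refine integral_congr_ae ?_
    filter_upwards [(memLp_tensor hh hc).coeFn_toLp] with x hx
    rw [hx]
  rw [Fin.sum_univ_castSucc] at key
  simp only [hG, hG2] at key
  rw [← key]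
  exact congrArg₂ (· + ·)
    (Finset.sum_congr rfl fun j _ => (ev (w j.castSucc) (hg j) hc.continuous).symm)
    (ev (w 2) hf hc').symm

/-! ### The non-constant vertical modes -/

lemma ae_eq_zero_of_integral_mul_self {μ : Measure Plane} {f : Plane → ℝ} (hf : MemLp f 2 μ)
    (h : ∫ x, f x * f x ∂μ = 0) : f =ᵐ[μ] 0 := by
  have h1 := (integral_eq_zero_iff_of_nonneg (fun x => mul_self_nonneg (f x))
    (hf.integrable_mul hf)).1 h
  filter_upwards [h1] with x hx
  exact mul_self_eq_zero.1 hx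

/-- The Fourier modes of order `k ≥ 1` of an orthogonal field vanish: since `-κ (w_h)_k` is the
gradient of `(w₃)_k`, the normal trace can be tested with `(w₃)_k ⊗ cos(κ ·)`, which gives
`‖(w_h)_k‖² + ‖(w₃)_k‖² = 0`. -/
lemma IsOrthogonal.vertCoeff_eq_zero (hbdd : Bornology.IsBounded (Ω : Set Plane))
    {w z : L2Field (cylinder Ω)} (hdiv : IsDivFree w) (hn : NormalTraceEqZero w)
    (hz : ∀ i, HasWeakPartial 2 (w i) (z i)) (h : IsOrthogonal w z) {k : ℕ} (hk : k ≠ 0) :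
    (∀ j : Fin 2, vertCoeff (w j.castSucc) (fun t => Real.cos (k * Real.pi * t))
        =ᵐ[volume.restrict (Ω : Set Plane)] 0) ∧
      vertCoeff (w 2) (fun t => Real.sin (k * Real.pi * t))
        =ᵐ[volume.restrict (Ω : Set Plane)] 0 := by
  set κ : ℝ := k * Real.pi with hκdef
  have hκ : 0 < κ := by positivity
  set c : ℝ → ℝ := fun t => Real.cos (κ * t) with hcdef
  set s : ℝ → ℝ := fun t => Real.sin (κ * t) with hsdef
  have hc : ContDiff ℝ ∞ c := Real.contDiff_cos.comp (by fun_prop)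
  have hs : ContDiff ℝ ∞ s := Real.contDiff_sin.comp (by fun_prop)
  have hc' : deriv c = fun t => (-κ) * s t := by
    ext t
    have : HasDerivAt c (-Real.sin (κ * t) * (κ * 1)) t :=
      ((hasDerivAt_id t).const_mul κ).cos
    rw [this.deriv, hsdef]; ring
  set A : Fin 2 → Plane → ℝ := fun j => vertCoeff (w j.castSucc) c with hA
  set B := vertCoeff (w 2) s with hB
  have mA : ∀ j, MemLp (A j) 2 (volume.restrict (Ω : Set Plane)) := fun j =>
    memLp_vertCoeff _ hc.continuous
  have mB : MemLp B 2 (volume.restrict (Ω : Set Plane)) := memLp_vertCoeff _ hs.continuous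
  have hweak : ∀ j, HasPlaneWeakPartial Ω j B (fun x => (-κ) * A j x) := by
    intro j g hg
    have e := h.fourier hbdd hdiv hn hz hk j hg
    rw [integral_mul_tensor _ (hg.memLp _) hc.continuous,
      integral_mul_tensor _ ((hg.planeDeriv j).memLp _) hs.continuous] at e
    rw [← e, ← integral_const_mul, ← integral_neg]
    congr 1
    ext x
    ring
  have key := hn.tensor mB (fun j => (mA j).const_mul (-κ)) hweak hc
  have e1 : ∀ j, ∫ x in (Ω : Set Plane), vertCoeff (w j.castSucc) c x * (-κ * A j x) =
      -κ * ∫ x in (Ω : Set Plane), A j x * A j x := fun j => by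
    rw [← integral_const_mul]; congr 1; ext x; simp only [hA]; ring
  have e2 : ∫ x in (Ω : Set Plane), vertCoeff (w 2) (deriv c) x * B x =
      -κ * ∫ x in (Ω : Set Plane), B x * B x := by
    rw [← integral_const_mul]
    congr 1
    ext x
    have : vertCoeff (w 2) (deriv c) x = -κ * B x := by
      rw [hB, vertCoeff, vertCoeff, ← integral_const_mul, hc']
      congr 1
      ext t
      ring
    rw [this]; ring
  simp only [e1] at key
  rw [e2, ← Finset.mul_sum, ← mul_add] at key
  have h0 := (mul_eq_zero.1 key).resolve_left (neg_ne_zero.2 hκ.ne')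
  have p : ∀ f : Plane → ℝ, 0 ≤ ∫ x in (Ω : Set Plane), f x * f x := fun f =>
    integral_nonneg fun x => mul_self_nonneg _
  rw [Fin.sum_univ_two] at h0
  have q0 := p (A 0)
  have q1 := p (A 1)
  have q2 := p B
  refine ⟨fun j => ae_eq_zero_of_integral_mul_self (mA j) ?_,
    ae_eq_zero_of_integral_mul_self mB (by linarith)⟩
  fin_cases j
  · exact le_antisymm (by simp only [Fin.zero_eta]; linarith) (p _)
  · exact le_antisymm (by simp only [Fin.mk_one]; linarith) (p _)

/-! ### Curl-free fields on star-shaped plane domains -/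

/-- The dilation of the plane with centre `x₀` and ratio `τ`. -/
def dil (x₀ : Plane) (τ : ℝ) (x : Plane) : Plane := x₀ + τ • (x - x₀)

lemma dil_dil (x₀ : Plane) (σ τ : ℝ) (x : Plane) : dil x₀ σ (dil x₀ τ x) = dil x₀ (σ * τ) x := by
  simp [dil, smul_smul]

lemma dil_one (x₀ x : Plane) : dil x₀ 1 x = x := by simp [dil]

lemma dil_inv_dil (x₀ : Plane) {τ : ℝ} (hτ : τ ≠ 0) (x : Plane) : dil x₀ τ⁻¹ (dil x₀ τ x) = x := by
  rw [dil_dil, inv_mul_cancel₀ hτ, dil_one]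

lemma dil_contDiff (x₀ : Plane) (τ : ℝ) : ContDiff ℝ ∞ (dil x₀ τ) := by
  unfold dil; fun_prop

lemma dil_sub_apply (x₀ : Plane) (τ : ℝ) (x : Plane) (j : Fin 2) :
    (dil x₀ τ x) j - x₀ j = τ * (x j - x₀ j) := by
  simp [dil]

lemma integral_comp_dil (x₀ : Plane) (τ : ℝ) (f : Plane → ℝ) :
    ∫ x, f (dil x₀ τ x) = (τ ^ 2)⁻¹ * ∫ x, f x := by
  have h1 := integral_sub_right_eq_self (μ := (volume : Measure Plane))
    (fun x => f (x₀ + τ • x)) x₀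
  have h2 := Measure.integral_comp_smul (volume : Measure Plane) (fun x => f (x₀ + x)) τ
  have h3 := integral_add_left_eq_self (μ := (volume : Measure Plane)) f x₀
  rw [h3, finrank_euclideanSpace_fin] at h2
  unfold dil
  rw [h1, h2, smul_eq_mul, abs_of_nonneg (by positivity)]

lemma integrable_comp_dil (x₀ : Plane) {τ : ℝ} (hτ : τ ≠ 0) {f : Plane → ℝ} (hf : Integrable f) :
    Integrable (fun x => f (dil x₀ τ x)) :=
  ((hf.comp_add_left x₀).comp_smul hτ).comp_sub_right x₀

lemma hasFDerivAt_dil (x₀ : Plane) (τ : ℝ) (x : Plane) :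
    HasFDerivAt (dil x₀ τ) (τ • ContinuousLinearMap.id ℝ Plane) x :=
  (((hasFDerivAt_id x).sub_const x₀).const_smul τ).const_add x₀

lemma planeDeriv_comp_dil {φ : Plane → ℝ} (hφ : ContDiff ℝ ∞ φ) (x₀ : Plane) (τ : ℝ) (j : Fin 2)
    (x : Plane) : planeDeriv j (fun y => φ (dil x₀ τ y)) x = τ * planeDeriv j φ (dil x₀ τ x) := by
  have h := (hφ.differentiable (by simp) (dil x₀ τ x)).hasFDerivAt.comp x (hasFDerivAt_dil x₀ τ x)
  have h' : fderiv ℝ (fun y => φ (dil x₀ τ y)) x = _ := h.fderiv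
  rw [planeDeriv, h', planeDeriv]
  simp

lemma planeDeriv_coord_mul {Φ : Plane → ℝ} (hΦ : ContDiff ℝ ∞ Φ) (x₀ : Plane) {i j : Fin 2}
    (x : Plane) : planeDeriv i (fun y => (y j - x₀ j) * Φ y) x =
      (x j - x₀ j) * planeDeriv i Φ x + if j = i then Φ x else 0 := by
  have h1 : HasFDerivAt (fun y : Plane => y j - x₀ j)
      (EuclideanSpace.proj j : Plane →L[ℝ] ℝ) x :=
    (EuclideanSpace.proj j : Plane →L[ℝ] ℝ).hasFDerivAt.sub_const _
  have h2 : HasFDerivAt (fun y : Plane => (y j - x₀ j) * Φ y) _ x :=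
    h1.mul (hΦ.differentiable (by simp) x).hasFDerivAt
  rw [planeDeriv, h2.fderiv, planeDeriv]
  by_cases hij : j = i <;> simp [hij]

lemma fderiv_eq_sum_planeDeriv (φ : Plane → ℝ) (x v : Plane) :
    fderiv ℝ φ x v = ∑ j, v j * planeDeriv j φ x := by
  have hv : v = ∑ j, v j • EuclideanSpace.single j (1 : ℝ) := by
    ext i
    simp [Fin.sum_univ_two]
    fin_cases i <;> simp
  conv_lhs => rw [hv]
  simp [planeDeriv]


lemma IsPlaneTest.coord_mul {Ω : Set Plane} {Φ : Plane → ℝ} (h : IsPlaneTest Ω Φ) (x₀ : Plane)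
    (j : Fin 2) : IsPlaneTest Ω (fun y => (y j - x₀ j) * Φ y) := by
  refine ⟨?_, h.2.1.mul_left,
    (tsupport_mul_subset_right (f := fun y : Plane => y j - x₀ j)).trans h.2.2⟩
  have : ContDiff ℝ ∞ (fun y : Plane => y j) :=
    (EuclideanSpace.proj j : Plane →L[ℝ] ℝ).contDiff
  exact (this.sub contDiff_const).mul h.1

/-- Dilating a test function towards the centre of a star-shaped domain gives a test function. -/
lemma IsPlaneTest.comp_dil {Ω : Set Plane} {φ : Plane → ℝ} (h : IsPlaneTest Ω φ) {x₀ : Plane}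
    (hstar : StarConvex ℝ x₀ Ω) {τ : ℝ} (hτ : 1 ≤ τ) :
    IsPlaneTest Ω (fun y => φ (dil x₀ τ y)) := by
  have hτ0 : τ ≠ 0 := by positivity
  have hs : tsupport (fun y => φ (dil x₀ τ y)) ⊆ dil x₀ τ⁻¹ '' tsupport φ := by
    refine closure_minimal (fun y hy => ⟨dil x₀ τ y, subset_tsupport φ hy, dil_inv_dil x₀ hτ0 y⟩) ?_
    exact (h.2.1.isCompact.image (dil_contDiff x₀ _).continuous).isClosed
  refine ⟨h.1.comp (dil_contDiff x₀ τ), (h.2.1.isCompact.image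
    (dil_contDiff x₀ τ⁻¹).continuous).of_isClosed_subset (isClosed_tsupport _) hs, ?_⟩
  intro y hy
  obtain ⟨z, hz, rfl⟩ := hs hy
  exact hstar.add_smul_sub_mem (h.2.2 hz) (by positivity) (inv_le_one_of_one_le₀ hτ)

/-- A square-integrable plane field that is extended by zero outside `Ω` and curl-free in `Ω`. -/
structure IsCurlFree (Ω : Set Plane) (A : Fin 2 → Plane → ℝ) : Prop where
  measurable : ∀ j, Measurable (A j)
  memLp : ∀ j, MemLp (A j) 2 volume
  zero_of_notMem : ∀ j, ∀ x ∉ Ω, A j x = 0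
  curl : ∀ i j, ∀ φ, IsPlaneTest Ω φ → ∫ x, A j x * planeDeriv i φ x = ∫ x, A i x * planeDeriv j φ x

variable {A : Fin 2 → Plane → ℝ}

lemma IsCurlFree.integrable_mul {Ω : Set Plane} (hA : IsCurlFree Ω A) (j : Fin 2) {φ : Plane → ℝ}
    (hφ : IsPlaneTest Ω φ) : Integrable (fun x => A j x * φ x) := by
  have h : MemLp φ 2 volume := hφ.1.continuous.memLp_of_hasCompactSupport hφ.2.1
  exact (hA.memLp j).integrable_mul h

lemma IsCurlFree.integrable {Ω : Set Plane} (hA : IsCurlFree Ω A) (hb : Bornology.IsBounded Ω)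
    (j : Fin 2) : Integrable (A j) := by
  have hR : ∃ R, Ω ⊆ Metric.closedBall 0 R := hb.subset_closedBall 0
  obtain ⟨R, hR⟩ := hR
  have h1 : IntegrableOn (A j) (Metric.closedBall 0 R) := by
    have : IsFiniteMeasure (volume.restrict (Metric.closedBall (0 : Plane) R)) :=
      ⟨by rw [Measure.restrict_apply_univ]; exact Metric.isBounded_closedBall.measure_lt_top⟩
    exact ((hA.memLp j).restrict _).integrable (by norm_num)
  rwa [integrableOn_iff_integrable_of_support_subset] at h1
  intro x hx
  by_contra hx'
  exact hx (hA.zero_of_notMem j x fun h => hx' (hR h))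

/-- The weak form of `∇(A · (y - x₀)) = A + (y - x₀) · ∇A` for a curl-free field `A`. -/
lemma IsCurlFree.sum_integral_coord_mul {Ω : Set Plane} (hA : IsCurlFree Ω A) (x₀ : Plane)
    (i : Fin 2) {Φ : Plane → ℝ} (hΦ : IsPlaneTest Ω Φ) :
    ∑ j, ∫ y, A j y * ((y j - x₀ j) * planeDeriv i Φ y) =
      (∫ y, A i y * Φ y) + ∑ j, ∫ y, A i y * ((y j - x₀ j) * planeDeriv j Φ y) := by
  have key : ∀ j, j ≠ i → ∫ y, A j y * ((y j - x₀ j) * planeDeriv i Φ y) =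
      (∫ y, A i y * Φ y) + ∫ y, A i y * ((y j - x₀ j) * planeDeriv j Φ y) := by
    intro j hj
    have e := hA.curl i j _ (hΦ.coord_mul x₀ j)
    simp only [planeDeriv_coord_mul hΦ.1, if_neg hj, if_true, add_zero] at e
    rw [e, ← integral_add (hA.integrable_mul i hΦ)
      (hA.integrable_mul i ((hΦ.planeDeriv j).coord_mul x₀ j))]
    congr 1
    ext y
    ring
  rw [Fin.sum_univ_two, Fin.sum_univ_two]
  fin_cases i
  · have := key 1 (by decide)
    simp only [Fin.zero_eta] at this ⊢
    linarith
  · have := key 0 (by decide)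
    simp only [Fin.mk_one] at this ⊢
    linarith

lemma hasDerivAt_integral_mul_dil {a : Plane → ℝ} (ha : Integrable a) {Ω : Set Plane}
    (hb : Bornology.IsBounded Ω) (h0 : ∀ x ∉ Ω, a x = 0) {φ : Plane → ℝ} (hφ : IsPlaneTest Ω φ)
    (x₀ : Plane) (τ : ℝ) :
    HasDerivAt (fun τ => ∫ y, a y * (τ * φ (dil x₀ τ y)))
      (∫ y, a y * (φ (dil x₀ τ y) + τ * fderiv ℝ φ (dil x₀ τ y) (y - x₀))) τ := by
  obtain ⟨M, hM⟩ := hφ.2.1.exists_bound_of_continuous hφ.1.continuous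
  have hfc : Continuous (fderiv ℝ φ) := hφ.1.continuous_fderiv (by simp)
  obtain ⟨N, hN⟩ := (hφ.2.1.fderiv (𝕜 := ℝ)).exists_bound_of_continuous hfc
  obtain ⟨R, hR⟩ := hb.subset_closedBall x₀
  have hM0 : 0 ≤ M := (norm_nonneg _).trans (hM 0)
  have hN0 : 0 ≤ N := (norm_nonneg _).trans (hN 0)
  have hdc : ∀ σ, Continuous (dil x₀ σ) := fun σ => (dil_contDiff x₀ σ).continuous
  have c0 : ∀ σ, Continuous (fun y => σ * φ (dil x₀ σ y)) := fun σ =>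
    continuous_const.mul (hφ.1.continuous.comp (hdc σ))
  have c1 : Continuous (fun y => φ (dil x₀ τ y) + τ * fderiv ℝ φ (dil x₀ τ y) (y - x₀)) :=
    (hφ.1.continuous.comp (hdc τ)).add (continuous_const.mul
      ((hfc.comp (hdc τ)).clm_apply (continuous_id.sub continuous_const)))
  refine (hasDerivAt_integral_of_dominated_loc_of_deriv_le (𝕜 := ℝ)
    (F := fun σ y => a y * (σ * φ (dil x₀ σ y)))
    (F' := fun σ y => a y * (φ (dil x₀ σ y) + σ * fderiv ℝ φ (dil x₀ σ y) (y - x₀)))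
    (bound := fun y => |a y| * (M + (|τ| + 1) * (N * |R|)))
    (Metric.ball_mem_nhds τ one_pos) (Eventually.of_forall fun σ =>
      ha.1.mul (c0 σ).aestronglyMeasurable) ?_ (ha.1.mul c1.aestronglyMeasurable) ?_
    (ha.abs.mul_const _) ?_).2
  · refine ha.mul_bdd (c := |τ| * M) (c0 τ).aestronglyMeasurable (ae_of_all _ fun y => ?_)
    rw [norm_mul, Real.norm_eq_abs]
    exact mul_le_mul_of_nonneg_left (hM _) (abs_nonneg _)
  · refine ae_of_all _ fun y σ hσ => ?_
    by_cases hy : y ∈ Ω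
    · rw [norm_mul, Real.norm_eq_abs]
      refine mul_le_mul_of_nonneg_left ((norm_add_le _ _).trans (add_le_add (hM _) ?_))
        (abs_nonneg _)
      rw [norm_mul, Real.norm_eq_abs]
      have h1 : |σ| ≤ |τ| + 1 := by
        have h2 : |σ - τ| < 1 := hσ
        have h3 := abs_add_le (σ - τ) τ
        rw [sub_add_cancel] at h3
        linarith
      have h2 : ‖y - x₀‖ ≤ |R| := by
        rw [← dist_eq_norm]
        exact (hR hy).trans (le_abs_self R)
      exact mul_le_mul h1 (((fderiv ℝ φ _).le_opNorm _).trans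
        (mul_le_mul (hN _) h2 (norm_nonneg _) hN0)) (norm_nonneg _) (by positivity)
    · simp [h0 y hy]
  · refine ae_of_all _ fun y σ _ => ?_
    have hd : HasDerivAt (fun σ => dil x₀ σ y) (y - x₀) σ := by
      have := ((hasDerivAt_id σ).smul_const (y - x₀)).const_add x₀
      simpa [dil] using this
    have h1 : HasDerivAt (fun σ => φ (dil x₀ σ y)) (fderiv ℝ φ (dil x₀ σ y) (y - x₀)) σ :=
      (hφ.1.differentiable (by simp) (dil x₀ σ y)).hasFDerivAt.comp_hasDerivAt σ hd
    have h2 := ((hasDerivAt_id σ).mul h1).const_mul (a y)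
    simpa using h2

/-- The integrand of the truncated radial potential. -/
def radialIntegrand (A : Fin 2 → Plane → ℝ) (x₀ : Plane) (p : Plane × ℝ) : ℝ :=
  ∑ j, A j (dil x₀ p.2⁻¹ p.1) * ((p.1 j - x₀ j) * (p.2 ^ 2)⁻¹)

/-- The truncated radial potential `∫_λ^1 A(x₀ + t (x - x₀)) · (x - x₀) dt`, with `λ = 1/Λ` and
`t = 1/τ`. Unlike the full potential (`λ = 0`), it is square-integrable for `A ∈ L²`. -/
def radialPotential (A : Fin 2 → Plane → ℝ) (x₀ : Plane) (Λ : ℝ) (x : Plane) : ℝ :=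
  ∫ τ in Ioc 1 Λ, radialIntegrand A x₀ (x, τ)

lemma measurable_dil_inv (x₀ : Plane) : Measurable fun p : Plane × ℝ => dil x₀ p.2⁻¹ p.1 := by
  unfold dil
  fun_prop

lemma memLp_comp_dil_inv {a : Plane → ℝ} (hm : Measurable a) (ha : MemLp a 2 volume) (x₀ : Plane)
    (Λ : ℝ) : MemLp (fun p : Plane × ℝ => a (dil x₀ p.2⁻¹ p.1)) 2
      ((volume : Measure Plane).prod (volume.restrict (Ioc 1 Λ))) := by
  have hm' : Measurable fun p : Plane × ℝ => a (dil x₀ p.2⁻¹ p.1) :=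
    hm.comp (measurable_dil_inv x₀)
  rw [memLp_two_iff_integrable_sq hm'.aestronglyMeasurable,
    integrable_prod_iff' (hm'.pow_const 2).aestronglyMeasurable]
  constructor
  · refine (ae_restrict_iff' measurableSet_Ioc).2 (ae_of_all _ fun τ hτ => ?_)
    have hτ0 : τ⁻¹ ≠ 0 := inv_ne_zero (by linarith [hτ.1])
    exact integrable_comp_dil x₀ hτ0 (f := fun x => a x ^ 2) ha.integrable_sq
  · have e : ∀ τ : ℝ, ∫ x, ‖a (dil x₀ τ⁻¹ x) ^ 2‖ = τ ^ 2 * ∫ x, ‖a x ^ 2‖ := fun τ => by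
      rw [integral_comp_dil x₀ τ⁻¹ (fun x => ‖a x ^ 2‖), inv_pow, inv_inv]
    simp only [e]
    exact ((continuous_pow 2).mul continuous_const).integrableOn_Ioc

lemma IsCurlFree.memLp_radialIntegrand (hA : IsCurlFree Ω A)
    (hb : Bornology.IsBounded (Ω : Set Plane)) (x₀ : Plane) (Λ : ℝ) :
    MemLp (radialIntegrand A x₀) 2
      ((volume.restrict (Ω : Set Plane)).prod (volume.restrict (Ioc 1 Λ))) := by
  obtain ⟨R, hR⟩ := hb.subset_closedBall x₀
  unfold radialIntegrand
  refine memLp_finsetSum _ fun j _ => ?_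
  have h1 : MemLp (fun p : Plane × ℝ => A j (dil x₀ p.2⁻¹ p.1)) 2
      ((volume.restrict (Ω : Set Plane)).prod (volume.restrict (Ioc 1 Λ))) :=
    (memLp_comp_dil_inv (hA.measurable j) (hA.memLp j) x₀ Λ).mono_measure
      (Measure.prod_mono Measure.restrict_le_self le_rfl)
  have hm : Measurable fun p : Plane × ℝ => (p.1 j - x₀ j) * (p.2 ^ 2)⁻¹ := by fun_prop
  refine MemLp.of_le_mul (c := |R|) h1 (h1.1.mul hm.aestronglyMeasurable) ?_
  rw [Measure.prod_restrict]
  refine (ae_restrict_iff' (Ω.isOpen.measurableSet.prod measurableSet_Ioc)).2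
    (ae_of_all _ fun p hp => ?_)
  rw [norm_mul, mul_comm]
  refine mul_le_mul_of_nonneg_right ?_ (norm_nonneg _)
  rw [norm_mul]
  have e1 : ‖p.1 j - x₀ j‖ ≤ |R| := by
    have := PiLp.norm_apply_le (p.1 - x₀) j
    refine this.trans ?_
    rw [← dist_eq_norm]
    exact (hR hp.1).trans (le_abs_self R)
  have e2 : ‖(p.2 ^ 2)⁻¹‖ ≤ 1 := by
    rw [Real.norm_eq_abs, abs_of_nonneg (by positivity)]
    exact inv_le_one_of_one_le₀ (one_le_pow₀ hp.2.1.le)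
  calc _ ≤ |R| * 1 := mul_le_mul e1 e2 (norm_nonneg _) (abs_nonneg _)
    _ = |R| := mul_one _

lemma IsCurlFree.memLp_radialPotential (hA : IsCurlFree Ω A)
    (hb : Bornology.IsBounded (Ω : Set Plane)) (x₀ : Plane) (Λ : ℝ) :
    MemLp (radialPotential A x₀ Λ) 2 (volume.restrict (Ω : Set Plane)) :=
  memLp_two_integral_prod (hA.memLp_radialIntegrand hb x₀ Λ)

/-- For a curl-free field the pairing of the radial integrand at `τ` with `∂ᵢφ` is the `τ`-derivative
of `∫ Aᵢ(y) τ φ(x₀ + τ (y - x₀)) dy`. For `τ ≥ 1` the dilated function is again a test function on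
`Ω`, because `Ω` is star-shaped. -/
lemma IsCurlFree.integral_radialIntegrand_mul (hA : IsCurlFree Ω A) {x₀ : Plane}
    (hstar : StarConvex ℝ x₀ (Ω : Set Plane)) (i : Fin 2) {φ : Plane → ℝ} (hφ : IsPlaneTest Ω φ)
    {τ : ℝ} (hτ : 1 ≤ τ) :
    ∫ x in (Ω : Set Plane), radialIntegrand A x₀ (x, τ) * planeDeriv i φ x =
      ∫ y, A i y * (φ (dil x₀ τ y) + τ * fderiv ℝ φ (dil x₀ τ y) (y - x₀)) := by
  have hτ0 : τ ≠ 0 := by positivity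
  have hΦ := hφ.comp_dil hstar hτ
  have e1 : ∫ x in (Ω : Set Plane), radialIntegrand A x₀ (x, τ) * planeDeriv i φ x =
      ∫ x, radialIntegrand A x₀ (x, τ) * planeDeriv i φ x :=
    setIntegral_eq_integral_of_forall_compl_eq_zero fun x hx => by
      rw [image_eq_zero_of_notMem_tsupport fun h => hx ((hφ.planeDeriv i).2.2 h), mul_zero]
  -- change of variables `x = x₀ + τ (y - x₀)`
  have e2 := integral_comp_dil x₀ τ fun x => radialIntegrand A x₀ (x, τ) * planeDeriv i φ x
  have e3 : ∀ y, radialIntegrand A x₀ (dil x₀ τ y, τ) * planeDeriv i φ (dil x₀ τ y) =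
      (τ ^ 2)⁻¹ * ∑ j, A j y * ((y j - x₀ j) *
        planeDeriv i (fun y => φ (dil x₀ τ y)) y) := fun y => by
    simp only [radialIntegrand, dil_inv_dil x₀ hτ0, dil_sub_apply, planeDeriv_comp_dil hφ.1]
    rw [Finset.sum_mul, Finset.mul_sum]
    exact Finset.sum_congr rfl fun j _ => by ring
  simp only [e3] at e2
  rw [integral_const_mul] at e2
  have e4 := mul_left_cancel₀ (inv_ne_zero (pow_ne_zero 2 hτ0)) e2
  rw [e1, ← e4, integral_finsetSum _ fun j _ =>
    hA.integrable_mul j ((hΦ.planeDeriv i).coord_mul x₀ j), hA.sum_integral_coord_mul x₀ i hΦ,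
    ← integral_finsetSum _ fun j _ => hA.integrable_mul i ((hΦ.planeDeriv j).coord_mul x₀ j),
    ← integral_add (hA.integrable_mul i hΦ) (integrable_finsetSum _ fun j _ =>
      hA.integrable_mul i ((hΦ.planeDeriv j).coord_mul x₀ j))]
  congr 1
  ext y
  rw [← Finset.mul_sum, ← mul_add, fderiv_eq_sum_planeDeriv, Finset.mul_sum]
  congr 2
  refine Finset.sum_congr rfl fun j _ => ?_
  rw [planeDeriv_comp_dil hφ.1, PiLp.sub_apply]
  ring

/-- Poincaré's homotopy formula: on a star-shaped domain, the truncated radial potential of a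
curl-free field `A` has the gradient `A - λ A(x₀ + λ (· - x₀))`. -/
lemma IsCurlFree.hasPlaneWeakPartial_radialPotential (hA : IsCurlFree Ω A)
    (hb : Bornology.IsBounded (Ω : Set Plane)) {x₀ : Plane}
    (hstar : StarConvex ℝ x₀ (Ω : Set Plane)) {Λ : ℝ} (hΛ : 1 ≤ Λ) (i : Fin 2) :
    HasPlaneWeakPartial Ω i (radialPotential A x₀ Λ)
      (fun x => A i x - Λ⁻¹ * A i (dil x₀ Λ⁻¹ x)) := by
  intro φ hφ
  have hΛ0 : Λ ≠ 0 := by positivity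
  set G : ℝ → ℝ := fun τ => ∫ y, A i y * (τ * φ (dil x₀ τ y)) with hG
  set G' : ℝ → ℝ := fun τ =>
    ∫ y, A i y * (φ (dil x₀ τ y) + τ * fderiv ℝ φ (dil x₀ τ y) (y - x₀)) with hG'
  have hderiv : ∀ τ, HasDerivAt G (G' τ) τ := fun τ =>
    hasDerivAt_integral_mul_dil (hA.integrable hb i) hb (hA.zero_of_notMem i) hφ x₀ τ
  have hslice : ∀ τ ∈ Ioc 1 Λ,
      ∫ x in (Ω : Set Plane), radialIntegrand A x₀ (x, τ) * planeDeriv i φ x = G' τ :=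
    fun τ hτ => hA.integral_radialIntegrand_mul hstar i hφ hτ.1.le
  have hint : Integrable (fun p : Plane × ℝ => radialIntegrand A x₀ p * planeDeriv i φ p.1)
      ((volume.restrict (Ω : Set Plane)).prod (volume.restrict (Ioc 1 Λ))) := by
    have h : MemLp (fun p : Plane × ℝ => planeDeriv i φ p.1) 2
        ((volume.restrict (Ω : Set Plane)).prod (volume.restrict (Ioc 1 Λ))) :=
      ((hφ.planeDeriv i).memLp Ω).comp_fst _
    exact (hA.memLp_radialIntegrand hb x₀ Λ).integrable_mul h
  have hGint : IntegrableOn G' (Ioc 1 Λ) :=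
    (hint.integral_prod_right).congr
      ((ae_restrict_iff' measurableSet_Ioc).2 (ae_of_all _ hslice))
  have e1 : ∫ x in (Ω : Set Plane), radialPotential A x₀ Λ x * planeDeriv i φ x = G Λ - G 1 := by
    calc _ = ∫ x in (Ω : Set Plane), ∫ τ in Ioc 1 Λ,
          radialIntegrand A x₀ (x, τ) * planeDeriv i φ x := by
          congr 1; ext x; rw [radialPotential, ← integral_mul_const]
      _ = ∫ τ in Ioc 1 Λ, ∫ x in (Ω : Set Plane),
          radialIntegrand A x₀ (x, τ) * planeDeriv i φ x := integral_integral_swap hint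
      _ = ∫ τ in Ioc 1 Λ, G' τ := setIntegral_congr_fun measurableSet_Ioc hslice
      _ = ∫ τ in (1 : ℝ)..Λ, G' τ := (intervalIntegral.integral_of_le hΛ).symm
      _ = G Λ - G 1 := intervalIntegral.integral_eq_sub_of_hasDerivAt (fun τ _ => hderiv τ)
          ((intervalIntegrable_iff_integrableOn_Ioc_of_le hΛ).2 hGint)
  have e2 : G Λ = ∫ x, Λ⁻¹ * A i (dil x₀ Λ⁻¹ x) * φ x := by
    have := integral_comp_dil x₀ Λ fun x => Λ⁻¹ * A i (dil x₀ Λ⁻¹ x) * φ x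
    simp only [dil_inv_dil x₀ hΛ0] at this
    rw [eq_inv_mul_iff_mul_eq₀ (pow_ne_zero 2 hΛ0), ← integral_const_mul] at this
    rw [← this]
    refine integral_congr_ae (ae_of_all _ fun y => ?_)
    field_simp
  have e3 : G 1 = ∫ x, A i x * φ x := by
    simp only [hG, dil_one, one_mul]
  have e4 : ∫ x in (Ω : Set Plane), (A i x - Λ⁻¹ * A i (dil x₀ Λ⁻¹ x)) * φ x =
      ∫ x, (A i x - Λ⁻¹ * A i (dil x₀ Λ⁻¹ x)) * φ x :=
    setIntegral_eq_integral_of_forall_compl_eq_zero fun x hx => by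
      rw [image_eq_zero_of_notMem_tsupport fun h => hx (hφ.2.2 h), mul_zero]
  have i1 : Integrable fun x => Λ⁻¹ * A i (dil x₀ Λ⁻¹ x) * φ x := by
    obtain ⟨M, hM⟩ := hφ.2.1.exists_bound_of_continuous hφ.1.continuous
    exact ((integrable_comp_dil x₀ (inv_ne_zero hΛ0) (hA.integrable hb i)).const_mul _).mul_bdd
      (c := M) hφ.1.continuous.aestronglyMeasurable (ae_of_all _ hM)
  rw [e1, e2, e3, e4, ← integral_sub i1 (hA.integrable_mul i hφ), ← integral_neg]
  congr 1
  ext x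
  ring

/-- The fields `λ A(x₀ + λ (· - x₀))` tend to zero in `L²(Ω)` as `λ = 1/n → 0`: in dimension two
their norm is that of `A` on the shrinking domain `x₀ + λ (Ω - x₀)`. -/
lemma tendsto_integral_sq_dil {a : Plane → ℝ} (ha : MemLp a 2 volume)
    (hb : Bornology.IsBounded (Ω : Set Plane)) (x₀ : Plane) :
    Tendsto (fun n : ℕ => ∫ x in (Ω : Set Plane),
      ((n + 1 : ℝ)⁻¹ * a (dil x₀ (n + 1 : ℝ)⁻¹ x)) ^ 2) atTop (𝓝 0) := by
  have e : ∀ n : ℕ, ∫ x in (Ω : Set Plane), ((n + 1 : ℝ)⁻¹ * a (dil x₀ (n + 1 : ℝ)⁻¹ x)) ^ 2 =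
      ∫ y, (Ω : Set Plane).indicator (fun _ => (1 : ℝ)) (dil x₀ (n + 1) y) * a y ^ 2 := by
    intro n
    have hn : (n + 1 : ℝ) ≠ 0 := by positivity
    have h := integral_comp_dil x₀ (n + 1) fun x => (Ω : Set Plane).indicator
      (fun x => ((n + 1 : ℝ)⁻¹ * a (dil x₀ (n + 1 : ℝ)⁻¹ x)) ^ 2) x
    rw [integral_indicator Ω.isOpen.measurableSet, eq_inv_mul_iff_mul_eq₀ (pow_ne_zero 2 hn),
      ← integral_const_mul] at h
    rw [← h]
    congr 1
    ext y
    by_cases hy : dil x₀ (n + 1) y ∈ (Ω : Set Plane)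
    · simp only [indicator_of_mem hy, dil_inv_dil x₀ hn]
      field_simp
    · simp only [indicator_of_notMem hy, mul_zero, zero_mul]
  simp only [e]
  rw [← integral_zero Plane ℝ (μ := volume)]
  refine tendsto_integral_of_dominated_convergence (fun y => a y ^ 2) (fun n => ?_)
    ha.integrable_sq (fun n => ae_of_all _ fun y => ?_) ?_
  · refine AEStronglyMeasurable.mul ?_ (ha.1.pow 2)
    exact ((measurable_const.indicator Ω.isOpen.measurableSet).comp
      (dil_contDiff x₀ _).continuous.measurable).aestronglyMeasurable
  · rw [norm_mul, Real.norm_of_nonneg (sq_nonneg (a y))]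
    refine mul_le_of_le_one_left (sq_nonneg _) ?_
    by_cases hy : dil x₀ (n + 1) y ∈ (Ω : Set Plane) <;> simp [hy]
  · obtain ⟨R, hR⟩ := hb.subset_closedBall x₀
    have hne : ∀ᵐ y ∂(volume : Measure Plane), y ≠ x₀ := Measure.ae_ne volume x₀
    filter_upwards [hne] with y hy
    refine tendsto_const_nhds.congr' ?_
    have hpos : 0 < ‖y - x₀‖ := norm_pos_iff.2 (sub_ne_zero.2 hy)
    obtain ⟨m, hm⟩ := exists_nat_gt (R / ‖y - x₀‖)
    filter_upwards [eventually_ge_atTop m] with n hn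
    rw [indicator_of_notMem, zero_mul]
    intro hmem
    have h1 := hR hmem
    rw [Metric.mem_closedBall, dist_eq_norm, dil, add_sub_cancel_left, norm_smul,
      Real.norm_of_nonneg (by positivity)] at h1
    rw [div_lt_iff₀ hpos] at hm
    have h2 : (m : ℝ) ≤ n := by exact_mod_cast hn
    nlinarith

/-- On a star-shaped domain, a curl-free field orthogonal to all gradients of `H¹` functions
vanishes. -/
lemma IsCurlFree.ae_eq_zero (hA : IsCurlFree Ω A) (hb : Bornology.IsBounded (Ω : Set Plane))
    {x₀ : Plane} (hstar : StarConvex ℝ x₀ (Ω : Set Plane))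
    (horth : ∀ (f : Plane → ℝ) (g : Fin 2 → Plane → ℝ),
      MemLp f 2 (volume.restrict (Ω : Set Plane)) →
      (∀ j, MemLp (g j) 2 (volume.restrict (Ω : Set Plane))) →
      (∀ j, HasPlaneWeakPartial Ω j f (g j)) →
      ∑ j, ∫ x in (Ω : Set Plane), A j x * g j x = 0) (j : Fin 2) :
    A j =ᵐ[volume.restrict (Ω : Set Plane)] 0 := by
  set μ := volume.restrict (Ω : Set Plane) with hμ
  have mA : ∀ j, MemLp (A j) 2 μ := fun j => (hA.memLp j).restrict _
  set B : ℕ → Fin 2 → Plane → ℝ := fun n j x =>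
    (n + 1 : ℝ)⁻¹ * A j (dil x₀ (n + 1 : ℝ)⁻¹ x) with hB
  have mB : ∀ n j, MemLp (B n j) 2 μ := fun n j => by
    have hn : (n + 1 : ℝ)⁻¹ ≠ 0 := by positivity
    have : MemLp (fun x => A j (dil x₀ (n + 1 : ℝ)⁻¹ x)) 2 volume := by
      have hm : Measurable (fun x => A j (dil x₀ (n + 1 : ℝ)⁻¹ x)) :=
        (hA.measurable j).comp (dil_contDiff x₀ _).continuous.measurable
      rw [memLp_two_iff_integrable_sq hm.aestronglyMeasurable]
      exact integrable_comp_dil x₀ hn (f := fun x => A j x ^ 2) (hA.memLp j).integrable_sq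
    exact (this.restrict _).const_mul _
  have h1 : ∀ n, ∑ j, ∫ x, A j x * (A j x - B n j x) ∂μ = 0 := fun n =>
    horth (radialPotential A x₀ (n + 1)) (fun j x => A j x - B n j x)
      (hA.memLp_radialPotential hb x₀ _) (fun j => (mA j).sub (mB n j))
      (fun j => hA.hasPlaneWeakPartial_radialPotential hb hstar (by simp) j)
  have h2 : ∀ n, ∑ j, ∫ x, A j x * A j x ∂μ ≤ ∑ j, ∫ x, B n j x ^ 2 ∂μ := by
    intro n
    have h3 : ∀ j, ∫ x, A j x * A j x ∂μ ≤
        ∫ x, B n j x ^ 2 ∂μ + 2 * ∫ x, A j x * (A j x - B n j x) ∂μ := by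
      intro j
      have i1 := (mA j).integrable_mul (mA j)
      have i2 := (mB n j).integrable_sq
      have i3 : Integrable (fun x => 2 * (A j x * (A j x - B n j x))) μ :=
        ((mA j).integrable_mul ((mA j).sub (mB n j))).const_mul 2
      rw [← integral_const_mul, ← integral_add i2 i3]
      refine integral_mono i1 (i2.add i3) fun x => ?_
      change A j x * A j x ≤ B n j x ^ 2 + 2 * (A j x * (A j x - B n j x))
      nlinarith [sq_nonneg (A j x - B n j x)]
    calc _ ≤ ∑ j, (∫ x, B n j x ^ 2 ∂μ + 2 * ∫ x, A j x * (A j x - B n j x) ∂μ) :=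
          Finset.sum_le_sum fun j _ => h3 j
      _ = _ := by rw [Finset.sum_add_distrib, ← Finset.mul_sum, h1, mul_zero, add_zero]
  have h4 : Tendsto (fun n => ∑ j, ∫ x, B n j x ^ 2 ∂μ) atTop (𝓝 (∑ _j : Fin 2, 0)) :=
    tendsto_finsetSum _ fun j _ => tendsto_integral_sq_dil (hA.memLp j) hb x₀
  rw [Finset.sum_const_zero] at h4
  have h5 : ∑ j, ∫ x, A j x * A j x ∂μ ≤ 0 := ge_of_tendsto' h4 h2
  have h6 : ∀ j, 0 ≤ ∫ x, A j x * A j x ∂μ := fun j => integral_nonneg fun x => mul_self_nonneg _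
  exact ae_eq_zero_of_integral_mul_self (mA j) (le_antisymm
    ((Finset.single_le_sum (fun j _ => h6 j) (Finset.mem_univ j)).trans h5) (h6 j))

/-! ### Completeness of the cosines and sines on `(0,1)` -/

lemma integrable_mul_of_continuous {f : ℝ → ℝ} (hf : Integrable f (volume.restrict (Ioo (0 : ℝ) 1)))
    {g : ℝ → ℝ} (hg : Continuous g) :
    Integrable (fun t => f t * g t) (volume.restrict (Ioo (0 : ℝ) 1)) := by
  obtain ⟨C, hC⟩ := isCompact_Icc.exists_bound_of_continuousOn (s := Icc (0 : ℝ) 1) hg.continuousOn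
  exact hf.mul_bdd (c := C) hg.aestronglyMeasurable ((ae_restrict_iff' measurableSet_Ioo).2
    (ae_of_all _ fun t ht => hC t (Ioo_subset_Icc_self ht)))

/-- The functions `cos(kπt)` are complete on `(0,1)`: their span contains the polynomials in
`cos(πt)`, which are dense in the continuous functions since `t ↦ cos(πt)` is injective. -/
lemma ae_eq_zero_of_integral_mul_cos {f : ℝ → ℝ}
    (hf : Integrable f (volume.restrict (Ioo (0 : ℝ) 1)))
    (h : ∀ k : ℕ, ∫ t in Ioo (0 : ℝ) 1, f t * Real.cos (k * Real.pi * t) = 0) :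
    f =ᵐ[volume.restrict (Ioo (0 : ℝ) 1)] 0 := by
  set ν := (volume : Measure ℝ).restrict (Ioo (0 : ℝ) 1) with hν
  have hpow : ∀ n k : ℕ,
      ∫ t, f t * (Real.cos (Real.pi * t) ^ n * Real.cos (k * Real.pi * t)) ∂ν = 0 := by
    intro n
    induction n with
    | zero => intro k; simpa using h k
    | succ n ih =>
      intro k
      cases k with
      | zero =>
        have := ih 1
        simpa [pow_succ, mul_assoc] using this
      | succ k =>
        have e : ∀ t, f t * (Real.cos (Real.pi * t) ^ (n + 1) *
            Real.cos ((k + 1 : ℕ) * Real.pi * t)) =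
            2⁻¹ * (f t * (Real.cos (Real.pi * t) ^ n * Real.cos ((k + 2 : ℕ) * Real.pi * t)) +
              f t * (Real.cos (Real.pi * t) ^ n * Real.cos (k * Real.pi * t))) := by
          intro t
          have e1 : ((k + 2 : ℕ) : ℝ) * Real.pi * t =
              (k + 1 : ℕ) * Real.pi * t + Real.pi * t := by push_cast; ring
          have e2 : (k : ℝ) * Real.pi * t = (k + 1 : ℕ) * Real.pi * t - Real.pi * t := by
            push_cast; ring
          rw [e1, e2, Real.cos_add, Real.cos_sub]
          ring
        simp only [e]
        rw [integral_const_mul, integral_add, ih, ih, add_zero, mul_zero]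
        · exact integrable_mul_of_continuous hf (by fun_prop)
        · exact integrable_mul_of_continuous hf (by fun_prop)
  have hpoly : ∀ p : Polynomial ℝ, ∫ t, f t * p.eval (Real.cos (Real.pi * t)) ∂ν = 0 := by
    intro p
    simp only [Polynomial.eval_eq_sum_range, Finset.mul_sum]
    rw [integral_finsetSum _ fun n _ => integrable_mul_of_continuous hf (by fun_prop)]
    refine Finset.sum_eq_zero fun n _ => ?_
    have := hpow n 0
    simp only [Nat.cast_zero, zero_mul, Real.cos_zero, mul_one] at this
    have e : ∀ t, f t * (p.coeff n * Real.cos (Real.pi * t) ^ n) =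
        p.coeff n * (f t * Real.cos (Real.pi * t) ^ n) := fun t => by ring
    simp only [e]
    rw [integral_const_mul, this, mul_zero]
  have hcont : ∀ φ : ℝ → ℝ, Continuous φ → ∫ t, f t * φ t ∂ν = 0 := by
    intro φ hφ
    set S := ∫ t, |f t| ∂ν with hS
    have hS0 : 0 ≤ S := integral_nonneg fun t => abs_nonneg _
    have key : ∀ ε : ℝ, 0 < ε → |∫ t, f t * φ t ∂ν| ≤ S * ε := by
      intro ε hε
      obtain ⟨p, hp⟩ := exists_polynomial_near_of_continuousOn (-1) 1
        (fun y => φ (Real.arccos y / Real.pi))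
        (hφ.comp (Real.continuous_arccos.div_const _)).continuousOn ε hε
      have hpc : Continuous fun t => p.eval (Real.cos (Real.pi * t)) :=
        p.continuous.comp (by fun_prop)
      have e : ∫ t, f t * φ t ∂ν = ∫ t, f t * (φ t - p.eval (Real.cos (Real.pi * t))) ∂ν := by
        simp only [mul_sub]
        rw [integral_sub (integrable_mul_of_continuous hf hφ)
          (integrable_mul_of_continuous hf hpc), hpoly, sub_zero]
      rw [e, hS, ← integral_mul_const, ← Real.norm_eq_abs]
      refine norm_integral_le_of_norm_le (hf.abs.mul_const ε) ?_
      refine (ae_restrict_iff' measurableSet_Ioo).2 (ae_of_all _ fun t ht => ?_)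
      rw [norm_mul, Real.norm_eq_abs, Real.norm_eq_abs]
      refine mul_le_mul_of_nonneg_left ?_ (abs_nonneg _)
      have h1 := hp (Real.cos (Real.pi * t)) ⟨Real.neg_one_le_cos _, Real.cos_le_one _⟩
      rw [Real.arccos_cos (mul_nonneg Real.pi_pos.le ht.1.le)
        (mul_le_of_le_one_right Real.pi_pos.le ht.2.le), mul_div_cancel_left₀ _ Real.pi_ne_zero,
        abs_sub_comm] at h1
      exact h1.le
    by_contra hne
    have hpos := abs_pos.2 hne
    have := key (|∫ t, f t * φ t ∂ν| / (2 * (S + 1))) (by positivity)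
    rw [mul_div_assoc', le_div_iff₀ (by positivity)] at this
    nlinarith
  have h0 : ∀ᵐ t ∂(volume : Measure ℝ), t ∈ Ioo (0 : ℝ) 1 → f t = 0 := by
    refine isOpen_Ioo.ae_eq_zero_of_integral_contDiff_smul_eq_zero ?_ fun g hg _ hs => ?_
    · exact IntegrableOn.locallyIntegrableOn hf
    · rw [← hcont g hg.continuous]
      rw [hν, setIntegral_eq_integral_of_forall_compl_eq_zero]
      · simp only [smul_eq_mul, mul_comm]
      · intro t ht
        rw [image_eq_zero_of_notMem_tsupport fun h => ht (hs h), mul_zero]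
  exact (ae_restrict_iff' measurableSet_Ioo).2 h0

lemma ae_eq_zero_of_integral_mul_sin {f : ℝ → ℝ}
    (hf : Integrable f (volume.restrict (Ioo (0 : ℝ) 1)))
    (h : ∀ k : ℕ, ∫ t in Ioo (0 : ℝ) 1, f t * Real.sin (k * Real.pi * t) = 0) :
    f =ᵐ[volume.restrict (Ioo (0 : ℝ) 1)] 0 := by
  have hsin : Integrable (fun t => f t * Real.sin (Real.pi * t))
      (volume.restrict (Ioo (0 : ℝ) 1)) :=
    integrable_mul_of_continuous hf (by fun_prop)
  -- `sin(πt) cos(kπt)` is a combination of sines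
  have h0 := ae_eq_zero_of_integral_mul_cos hsin fun k => by
    cases k with
    | zero => simpa using h 1
    | succ k =>
      have e : ∀ t, f t * Real.sin (Real.pi * t) * Real.cos ((k + 1 : ℕ) * Real.pi * t) =
          2⁻¹ * (f t * Real.sin ((k + 2 : ℕ) * Real.pi * t) -
            f t * Real.sin (k * Real.pi * t)) := by
        intro t
        have e1 : ((k + 2 : ℕ) : ℝ) * Real.pi * t =
            (k + 1 : ℕ) * Real.pi * t + Real.pi * t := by push_cast; ring
        have e2 : (k : ℝ) * Real.pi * t = (k + 1 : ℕ) * Real.pi * t - Real.pi * t := by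
          push_cast; ring
        rw [e1, e2, Real.sin_add, Real.sin_sub]
        ring
      simp only [e]
      rw [integral_const_mul, integral_sub, h, h, sub_zero, mul_zero]
      · exact integrable_mul_of_continuous hf (by fun_prop)
      · exact integrable_mul_of_continuous hf (by fun_prop)
  filter_upwards [h0, ae_restrict_mem measurableSet_Ioo] with t ht htI
  refine (mul_eq_zero.1 ht).resolve_right (Real.sin_pos_of_pos_of_lt_pi ?_ ?_).ne'
  · exact mul_pos Real.pi_pos htI.1
  · exact mul_lt_of_lt_one_right Real.pi_pos htI.2

/-- If the profiles `cₖ` are complete on `(0,1)`, the corresponding vertical moments determine a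
function in `L²(Q)`: almost every slice vanishes, by Fubini. -/
lemma eq_zero_of_vertCoeff (hbdd : Bornology.IsBounded (Ω : Set Plane)) (f : L2 (cylinder Ω))
    (c : ℕ → ℝ → ℝ)
    (hc : ∀ g : ℝ → ℝ, Integrable g (volume.restrict (Ioo (0 : ℝ) 1)) →
      (∀ k, ∫ t in Ioo (0 : ℝ) 1, g t * c k t = 0) → g =ᵐ[volume.restrict (Ioo (0 : ℝ) 1)] 0)
    (h : ∀ k, vertCoeff f (c k) =ᵐ[volume.restrict (Ω : Set Plane)] 0) : f = 0 := by
  have : IsFiniteMeasure (volume.restrict (cylinder Ω)) :=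
    ⟨by rw [Measure.restrict_apply_univ]; exact volume_cylinder_lt_top hbdd⟩
  have hint : Integrable (fun x => f x)
      ((volume.restrict (Ω : Set Plane)).prod (volume.restrict (Ioo (0 : ℝ) 1))) := by
    rw [← restrict_cylinder]
    exact (Lp.memLp f).integrable (by norm_num)
  have hm : MeasurableSet {x : Space | f x = 0} :=
    measurableSet_eq_fun (Lp.stronglyMeasurable f).measurable measurable_const
  have h0 : ∀ᵐ x ∂((volume.restrict (Ω : Set Plane)).prod (volume.restrict (Ioo (0 : ℝ) 1))),
      f x = 0 := by
    rw [Measure.ae_prod_iff_ae_ae hm]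
    filter_upwards [ae_all_iff.2 h, hint.prod_right_ae] with x hx hxi
    exact hc _ hxi hx
  rw [← restrict_cylinder] at h0
  refine Lp.ext ?_
  filter_upwards [h0, Lp.coeFn_zero ℝ 2 (volume.restrict (cylinder Ω))] with x h1 h2
  rw [h1, h2, Pi.zero_apply]

/-! ### The vertical mean -/

lemma planeDeriv_comm {φ : Plane → ℝ} (hφ : ContDiff ℝ ∞ φ) (i j : Fin 2) (x : Plane) :
    planeDeriv i (planeDeriv j φ) x = planeDeriv j (planeDeriv i φ) x := by
  have hd : DifferentiableAt ℝ (fderiv ℝ φ) x :=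
    ((hφ.fderiv_right (m := ∞) (by simp)).differentiable (by simp)) x
  have e : ∀ i j : Fin 2, planeDeriv i (planeDeriv j φ) x =
      fderiv ℝ (fderiv ℝ φ) x (EuclideanSpace.single i 1) (EuclideanSpace.single j 1) := by
    intro i j
    have h : HasFDerivAt (planeDeriv j φ) _ x :=
      hd.hasFDerivAt.clm_apply (hasFDerivAt_const (EuclideanSpace.single j (1 : ℝ)) x)
    rw [planeDeriv, h.fderiv]
    simp
  rw [e, e]
  exact (hφ.contDiffAt.isSymmSndFDerivAt (by simpa using WithTop.coe_le_coe.2 (le_top : (2 : ℕ∞) ≤ ⊤))).eq _ _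

/-- Orthogonality to the fields `(∂₂φ, -∂₁φ, 0)`, `φ ∈ C_c^∞(Ω)`: the vertical mean of `w_h` is
curl-free. -/
lemma IsOrthogonal.curl_vertCoeff (hbdd : Bornology.IsBounded (Ω : Set Plane))
    {w z : L2Field (cylinder Ω)} (h : IsOrthogonal w z) {φ : Plane → ℝ} (hφ : IsPlaneTest Ω φ) :
    ∫ x in (Ω : Set Plane), vertCoeff (w 0) (fun _ => 1) x * planeDeriv 1 φ x =
      ∫ x in (Ω : Set Plane), vertCoeff (w 1) (fun _ => 1) x * planeDeriv 0 φ x := by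
  have h0 : IsPlaneTest Ω (fun _ : Plane => (0 : ℝ)) :=
    ⟨contDiff_const, HasCompactSupport.zero, by simp [tsupport]⟩
  have hneg : IsPlaneTest Ω (fun x => -planeDeriv 0 φ x) :=
    ⟨(hφ.planeDeriv 0).1.neg, (hφ.planeDeriv 0).2.1.neg, by
      have := (hφ.planeDeriv 0).2.2
      rwa [tsupport, show Function.support (fun x => -planeDeriv 0 φ x) =
        Function.support (planeDeriv 0 φ) from Function.support_neg _]⟩
  have key := h.productField hbdd (a := ![planeDeriv 1 φ, fun x => -planeDeriv 0 φ x])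
    (b := fun _ => 0) (c := fun _ => 1) (s := fun _ => 0) (M := 0)
    (fun j => by fin_cases j; exacts [hφ.planeDeriv 1, hneg]) h0 contDiff_const contDiff_const
    (by simp) (fun x t => by
      have e : planeDeriv 1 (fun x => -planeDeriv 0 φ x) x =
          -planeDeriv 1 (planeDeriv 0 φ) x := by
        rw [planeDeriv, fderiv_fun_neg]
        rfl
      rw [Fin.sum_univ_two]
      simp [e, planeDeriv_comm hφ.1 0 1])
  have e1 : tensor (fun _ => (0 : ℝ)) (fun _ => 0) = fun _ => 0 := by ext x; simp [tensor]
  have e2 : ∀ g : Plane → ℝ, tensor g (fun _ => 0) = fun _ => 0 := fun g => by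
    ext x; simp [tensor]
  have e3 : tensor (fun x => -planeDeriv 0 φ x) (fun _ => 1) =
      fun x => -tensor (planeDeriv 0 φ) (fun _ => 1) x := by ext x; simp [tensor]
  rw [Fin.sum_univ_two] at key
  simp only [deriv_const', e1, e2, mul_zero, integral_zero, add_zero, Matrix.cons_val_zero,
    Matrix.cons_val_one, e3, mul_neg, integral_neg] at key
  rw [← integral_mul_tensor _ ((hφ.planeDeriv 1).memLp _) continuous_const,
    ← integral_mul_tensor _ ((hφ.planeDeriv 0).memLp _) continuous_const]
  exact eq_of_sub_eq_zero (by rw [sub_eq_add_neg]; exact key)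

lemma IsOrthogonal.vertCoeff_one_eq_zero (hbdd : Bornology.IsBounded (Ω : Set Plane))
    {x₀ : Plane} (hstar : StarConvex ℝ x₀ (Ω : Set Plane))
    {w z : L2Field (cylinder Ω)} (hn : NormalTraceEqZero w) (h : IsOrthogonal w z) (j : Fin 2) :
    vertCoeff (w j.castSucc) (fun _ => 1) =ᵐ[volume.restrict (Ω : Set Plane)] 0 := by
  have mA := fun j : Fin 2 =>
    memLp_vertCoeff (w j.castSucc) (c := fun _ => (1 : ℝ)) continuous_const
  -- a measurable representative, extended by zero
  set A : Fin 2 → Plane → ℝ := fun j => (Ω : Set Plane).indicator ((mA j).1.mk _) with hAdef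
  have hAe : ∀ j, vertCoeff (w j.castSucc) (fun _ => 1)
      =ᵐ[volume.restrict (Ω : Set Plane)] A j := fun j => by
    filter_upwards [(mA j).1.ae_eq_mk, ae_restrict_mem Ω.isOpen.measurableSet] with x h1 h2
    rw [h1, hAdef]
    exact (indicator_of_mem h2 _).symm
  have hi : ∀ j (g : Plane → ℝ), ∫ x, A j x * g x =
      ∫ x in (Ω : Set Plane), vertCoeff (w j.castSucc) (fun _ => 1) x * g x := fun j g => by
    rw [← setIntegral_eq_integral_of_forall_compl_eq_zero (s := (Ω : Set Plane)) fun x hx => by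
      simp only [hAdef, indicator_of_notMem hx, zero_mul]]
    refine integral_congr_ae ?_
    filter_upwards [hAe j] with x hx
    rw [hx]
  have hcurl : ∀ φ, IsPlaneTest Ω φ →
      ∫ x, A 0 x * planeDeriv 1 φ x = ∫ x, A 1 x * planeDeriv 0 φ x := fun φ hφ => by
    rw [hi, hi]
    exact h.curl_vertCoeff hbdd hφ
  have hA : IsCurlFree Ω A :=
    { measurable := fun j =>
        ((mA j).1.stronglyMeasurable_mk.measurable).indicator Ω.isOpen.measurableSet
      memLp := fun j => by
        rw [hAdef, memLp_indicator_iff_restrict Ω.isOpen.measurableSet]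
        exact (memLp_congr_ae (mA j).1.ae_eq_mk).1 (mA j)
      zero_of_notMem := fun j x hx => indicator_of_notMem hx _
      curl := fun i j φ hφ => by
        fin_cases i <;> fin_cases j
        · rfl
        · exact (hcurl φ hφ).symm
        · exact hcurl φ hφ
        · rfl }
  refine (hAe j).trans (hA.ae_eq_zero hbdd hstar (fun f g hf hg hfg => ?_) j)
  have key := hn.tensor hf hg hfg (c := fun _ => 1) contDiff_const
  have e : vertCoeff (w 2) (deriv fun _ => (1 : ℝ)) = fun _ => 0 := by
    ext x
    simp [vertCoeff]
  simp only [e, zero_mul, integral_zero, add_zero] at key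
  rw [← key]
  refine Finset.sum_congr rfl fun j _ => integral_congr_ae ?_
  filter_upwards [hAe j] with x hx
  rw [hx]

/-- The orthogonal complement of `H̃¹₀(Q)` in `H̃^{0,1}(Q)` is trivial. -/
lemma IsOrthogonal.eq_zero (hbdd : Bornology.IsBounded (Ω : Set Plane))
    {x₀ : Plane} (hstar : StarConvex ℝ x₀ (Ω : Set Plane)) {w z : L2Field (cylinder Ω)}
    (hdiv : IsDivFree w) (hn : NormalTraceEqZero w) (hz : ∀ i, HasWeakPartial 2 (w i) (z i))
    (h : IsOrthogonal w z) : w = 0 := by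
  ext1 i
  refine Fin.lastCases ?_ (fun j => ?_) i
  · refine eq_zero_of_vertCoeff hbdd (w 2) (fun k t => Real.sin (k * Real.pi * t))
      (fun g hg => ae_eq_zero_of_integral_mul_sin hg) fun k => ?_
    rcases eq_or_ne k 0 with rfl | hk
    · refine ae_of_all _ fun x => ?_
      simp [vertCoeff]
    · exact (h.vertCoeff_eq_zero hbdd hdiv hn hz hk).2
  · refine eq_zero_of_vertCoeff hbdd (w j.castSucc) (fun k t => Real.cos (k * Real.pi * t))
      (fun g hg => ae_eq_zero_of_integral_mul_cos hg) fun k => ?_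
    rcases eq_or_ne k 0 with rfl | hk
    · simpa using h.vertCoeff_one_eq_zero hbdd hstar hn j
    · exact (h.vertCoeff_eq_zero hbdd hdiv hn hz hk).1 j

end AnisotropicNS

end

theorem mainTheorem6 (Ω : TopologicalSpace.Opens AnisotropicNS.Plane)
    (hbdd : Bornology.IsBounded (Ω : Set AnisotropicNS.Plane))
    (hsmooth : AnisotropicNS.HasSmoothBoundary (Ω : Set AnisotropicNS.Plane))
    (hstar : ∃ x₀ ∈ Ω, StarConvex ℝ x₀ (Ω : Set AnisotropicNS.Plane)) :
    AnisotropicNS.HTilde10 Ω ⊆ Set.range (AnisotropicNS.HTilde01.toL2 (Ω := Ω)) ∧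
      Dense {u : AnisotropicNS.HTilde01 Ω |
        AnisotropicNS.HTilde01.toL2 u ∈ AnisotropicNS.HTilde10 Ω} := by
  obtain ⟨x₀, -, hx₀⟩ := hstar
  exact ⟨fun u hu => ⟨⟨u, AnisotropicNS.HTilde10.mem_hTilde01 hbdd hu⟩, rfl⟩,
    AnisotropicNS.HTilde01.dense_of_orthogonal hbdd fun w z hdiv hn hz h =>
      h.eq_zero hbdd hx₀ hdiv hn hz⟩
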